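/- Let $V$ be a finite set, $n=|V|$, let $q\in\mathbb{N}$ and $[q]=\{0,1,\dots,q-1\}$, and let $\mu$ be a probability distribution on $[q]^V$ with support $\Omega=\{\sigma\in[q]^V:\mu(\sigma)>0\}$. For $\Lambda\subseteq V$, a partial configuration $\sigma_\Lambda\in[q]^\Lambda$ is called feasible if it extends to some $\sigma\in\Omega$. For a feasible $\sigma_\Lambda$ and $u\in V\setminus\Lambda$, let $\Omega_u^{\sigma_\Lambda}$ be the set of $i\in[q]$ such that $u$ has value $i$ with positive probability under $\mu$ conditioned on $\sigma_\Lambda$. For $i\in\Omega_u^{\sigma_\Lambda}$ let $\mu_v^{\sigma_\Lambda,u\leftarrow i}$ be the marginal distribution on $v$ of $\mu$ conditioned on the configuration on $\Lambda$ being $\sigma_\Lambda$ and on $u$ having value $i$. The influence matrix $\Psi_\mu^{\sigma_\Lambda}$, indexed by $V\setminus\Lambda$, has zero diagonal, and for $u\neq v$ $$\Psi_\mu^{\sigma_\Lambda}(u,v)=\max_{i,j\in\Omega_u^{\sigma_\Lambda}} d_{\mathrm{TV}}\bigl(\mu_v^{\sigma_\Lambda,u\leftarrow i},\,\mu_v^{\sigma_\Lambda,u\leftarrow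 j}\bigr),$$ where $d_{\mathrm{TV}}(f,g)=\frac12\sum_x|f(x)-g(x)|$. The distribution $\mu$ is called $(C,\eta)$-spectrally independent if for every $\Lambda\subseteq V$ with $|\Lambda|\le n-2$ and every feasible $\sigma_\Lambda\in[q]^\Lambda$, the spectral radius $\rho$ of $\Psi_\mu^{\sigma_\Lambda}$ (the largest modulus of a complex eigenvalue) satisfies $$\rho\bigl(\Psi_\mu^{\sigma_\Lambda}\bigr)\le C\qquad\text{and}\qquad \frac{\rho\bigl(\Psi_\mu^{\sigma_\Lambda}\bigr)}{n-|\Lambda|-1}\le\eta .$$ The Glauber dynamics for $\mu$ is the Markov chain on $\Omega$ that in each step chooses $v\in V$ uniformly at random and resamples the value of $v$ from its marginal distribution under $\mu$ conditioned on the current values of all other variables. Let $P$ be its transition matrix and, for $0<\epsilon<1$, let $$T_{\mathrm{mix}}(\epsilon)=\max_{x_0\in\Omega}\ \min\bigl\{t\in\mathbb{Z}_{\ge 0} : d_{\mathrm{TV}}\bigl(P^t(x_0,\cdot),\mu\bigr)\le\epsilon\bigr\}.$$ **Theorem.** If $\mu$ is $(C,\eta)$-spectrally independent, where $C\ge 0$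 and $0\le\eta<1$ are real numbers, then for every $0<\epsilon<1$ the mixing time of the Glauber dynamics for $\mu$ is finite and satisfies $$T_{\mathrm{mix}}(\epsilon)\le\frac{n^{1+2C}}{(1-\eta)^{2+2C}}\,\log\frac{1}{\epsilon\,\mu_{\min}},\qquad \mu_{\min}=\min\{\mu(\sigma):\sigma\in\Omega\}.$$ -/

import Mathlib

/-! Finite distributions on `[q]^V`, their influence matrices, and Glauber dynamics.

A distribution `μ` over `[q]^V` is given by its probability vector
`μ : (V → Fin q) → ℝ`, an element of `stdSimplex ℝ (V → Fin q)`. -/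

namespace SpinSystem

/-- The total variation distance `½ ∑ₐ |f a - g a|` of two distributions on a finite set. -/
noncomputable def tvDist {α : Type*} [Fintype α] (f g : α → ℝ) : ℝ :=
  (1 / 2) * ∑ a, |f a - g a|

section Conditioning

variable {V : Type*} [Fintype V] [DecidableEq V] {q : ℕ}

/-- The probability `μ(E)` of an event `E`. -/
noncomputable def prob (μ : (V → Fin q) → ℝ) (E : Set (V → Fin q)) : ℝ :=
  ∑ τ, E.indicator μ τ

/-- The marginal distribution on `v` of `μ` conditioned on the event `E`
(meaningful when `μ(E) > 0`). -/
noncomputable def condMarginal (μ : (V → Fin q) → ℝ) (E : Set (V → Fin q)) (v : V) :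
    Fin q → ℝ :=
  fun c => prob μ (E ∩ {τ | τ v = c}) / prob μ E

/-- The event that the configuration on `Λ` is the partial configuration `σ`. -/
def cylinder (Λ : Finset V) (σ : Λ → Fin q) : Set (V → Fin q) :=
  {τ | ∀ v : Λ, τ v = σ v}

/-- A partial configuration is feasible if it extends to a configuration of positive
probability. -/
def Feasible (μ : (V → Fin q) → ℝ) (Λ : Finset V) (σ : Λ → Fin q) : Prop :=
  ∃ τ ∈ cylinder Λ σ, 0 < μ τ

/-- The set of possible values of `u` given that the configuration on `Λ` is `σ`. -/
def possibleValues (μ : (V → Fin q) → ℝ) (Λ : Finset V) (σ : Λ → Fin q) (u : V) :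
    Set (Fin q) :=
  {i | 0 < condMarginal μ (cylinder Λ σ) u i}

/-- The marginal distribution on `v` of `μ`, conditioned on the configuration on `Λ`
being `σ` and on `u` having the value `i`. -/
noncomputable def pinnedMarginal (μ : (V → Fin q) → ℝ) (Λ : Finset V) (σ : Λ → Fin q)
    (u : V) (i : Fin q) (v : V) : Fin q → ℝ :=
  condMarginal μ (cylinder Λ σ ∩ {τ | τ u = i}) v

/-- The pairwise influence matrix of `μ` given `σ`, indexed by the vertices outside `Λ`.
For feasible `σ` the supremum is a maximum over a finite non-empty set. -/
noncomputable def influenceMatrix (μ : (V → Fin q) → ℝ) (Λ : Finset V) (σ : Λ → Fin q) :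
    Matrix {v // v ∉ Λ} {v // v ∉ Λ} ℝ :=
  fun u v =>
    if u = v then 0
    else ⨆ p : possibleValues μ Λ σ u × possibleValues μ Λ σ u,
      tvDist (pinnedMarginal μ Λ σ u p.1 v) (pinnedMarginal μ Λ σ u p.2 v)

end Conditioning

/-- The spectral radius of a real square matrix: the largest modulus of a complex
eigenvalue. -/
noncomputable def spectralRad {m : Type*} [Fintype m] [DecidableEq m]
    (A : Matrix m m ℝ) : ℝ :=
  (spectralRadius ℂ (A.map (fun x : ℝ => (x : ℂ)))).toReal

/-- No value is lost in passing from `ℝ≥0∞` to `ℝ` in the definition of the spectral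
radius. -/
theorem spectralRadius_matrix_ne_top {m : Type*} [Fintype m] [DecidableEq m]
    (A : Matrix m m ℂ) : spectralRadius ℂ A ≠ ⊤ := by
  have hfin : (spectrum ℂ A).Finite := A.finite_spectrum
  have hb : BddAbove ((fun z : ℂ => ‖z‖₊) '' spectrum ℂ A) := (hfin.image _).bddAbove
  obtain ⟨B, hB⟩ := hb
  have hle : spectralRadius ℂ A ≤ (B : ENNReal) := by
    unfold spectralRadius
    exact iSup₂_le fun z hz => by exact_mod_cast hB ⟨z, hz, rfl⟩
  exact ne_top_of_le_ne_top ENNReal.coe_ne_top hle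

section Dynamics

variable {V : Type*} [Fintype V] [DecidableEq V] {q : ℕ}

/-- `(C, η)`-spectral independence, with `n = |V|` and `k = |Λ| ≤ n - 2`. -/
def SpectrallyIndependent (μ : (V → Fin q) → ℝ) (C η : ℝ) : Prop :=
  ∀ Λ : Finset V, Λ.card + 2 ≤ Fintype.card V →
    ∀ σ : Λ → Fin q, Feasible μ Λ σ →
      spectralRad (influenceMatrix μ Λ σ) ≤ C ∧
      spectralRad (influenceMatrix μ Λ σ) / ((Fintype.card V : ℝ) - (Λ.card : ℝ) - 1) ≤ η

/-- The support of `μ`, the state space of the Glauber dynamics. -/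
abbrev Support (μ : (V → Fin q) → ℝ) : Type _ := {σ : V → Fin q // 0 < μ σ}

/-- The transition matrix of the Glauber dynamics: choose `v ∈ V` uniformly at random and
resample its value from the marginal distribution on `v` conditioned on the values of all
other variables. -/
noncomputable def glauber (μ : (V → Fin q) → ℝ) :
    Matrix (Support μ) (Support μ) ℝ :=
  fun σ τ =>
    (1 / (Fintype.card V : ℝ)) *
      ∑ v : V,
        if ∀ w, w ≠ v → τ.1 w = σ.1 w then
          condMarginal μ {ρ | ∀ w, w ≠ v → ρ w = σ.1 w} v (τ.1 v)
        else 0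

/-- The mixing time: the maximum over initial states `x₀` in the support of the least `t`
such that the law `P^t(x₀, ·)` is within total variation distance `ε` of `μ`; the value is
`⊤` if from some initial state there is no such `t`. -/
noncomputable def mixingTime (μ : (V → Fin q) → ℝ) (ε : ℝ) : ℕ∞ :=
  ⨆ x₀ : Support μ,
    ⨅ t : {t : ℕ // tvDist ((glauber μ ^ t) x₀) (fun σ : Support μ => μ σ.1) ≤ ε},
      ((t : ℕ) : ℕ∞)

/-- The least positive value of `μ`. -/
noncomputable def minProb (μ : (V → Fin q) → ℝ) : ℝ :=
  ⨅ σ : Support μ, μ σ.1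

end Dynamics

end SpinSystem

namespace SpinSystem

/-! Spectral independence yields a Poincaré inequality with constant `(1 - η) ^ (2 * C) / n ^ (1 + 2
* C)`, and this forces exponential decay in total variation.

The core is local (`eigenvalue_projMatrix_le`). Consider the operator `f ↦ ∑ᵤ (E[f | Xᵤ] - E f)`. An
eigenfunction with eigenvalue `b > 0` is centred and is a sum of one-site functions. Conditioning
the eigenvalue equation on `Xᵤ` gives `b Gᵤ = ∑ᵥ E[Gᵥ | Xᵤ]` for `Gᵤ = E[f | Xᵤ]`. The term `v = u`
is `Gᵤ` itself, and the others vary with `Xᵤ` by at most influence times oscillation. So the vector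
of oscillations satisfies `(b - 1) x ≤ R x`, and Collatz–Wielandt gives `b ≤ 1 + ρ(R)`. By the law
of total variance, revealing one of `k` free sites then retains, in sum over the sites, at least `k
- 1 - ρ` times the variance (`mul_scaledVar_le_sum_scaledVar`).

Pinning sites one at a time until a single one is free turns this into approximate tensorisation of
variance (`scaledVar_agreeOn_le`), with a product of factors `1 - min η (C / k)` as constant.
`le_prod_one_sub_min` bounds that product below. Since the Glauber kernel is positive semidefinite,
the Poincaré constant alone controls convergence (`tvDist_pow_le`). -/

/-! ### Spectral radius of nonnegative matrices -/

theorem spectralRad_nonneg {m : Type*} [Fintype m] [DecidableEq m] (A : Matrix m m ℝ) :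
    0 ≤ spectralRad A := ENNReal.toReal_nonneg

open Matrix in
theorem pow_mul_le_pow_mulVec {m : Type*} [Fintype m] [DecidableEq m] {R : Matrix m m ℝ}
    (hR : ∀ i j, 0 ≤ R i j) {x : m → ℝ} {c : ℝ} (hc : 0 ≤ c)
    (h : ∀ i, c * x i ≤ (R *ᵥ x) i) (k : ℕ) (i : m) : c ^ k * x i ≤ (R ^ k *ᵥ x) i := by
  induction k generalizing i with
  | zero => simp
  | succ k ih =>
    calc c ^ (k + 1) * x i = c ^ k * (c * x i) := by ring
      _ ≤ c ^ k * (R *ᵥ x) i := by gcongr; exact h i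
      _ = ∑ j, R i j * (c ^ k * x j) := by
          simp only [mulVec, dotProduct, Finset.mul_sum]
          exact Finset.sum_congr rfl fun j _ => by ring
      _ ≤ ∑ j, R i j * (R ^ k *ᵥ x) j :=
          Finset.sum_le_sum fun j _ => mul_le_mul_of_nonneg_left (ih j) (hR i j)
      _ = (R ^ (k + 1) *ᵥ x) i := by
          rw [pow_succ', ← mulVec_mulVec]
          rfl

section CollatzWielandt

attribute [local instance] Matrix.linftyOpNormedRing Matrix.linftyOpNormedAlgebra

open Matrix in
/-- The Collatz–Wielandt lower bound for the spectral radius of a nonnegative matrix. -/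
theorem le_spectralRad_of_mul_le_mulVec {m : Type*} [Fintype m] [DecidableEq m]
    {R : Matrix m m ℝ} (hR : ∀ i j, 0 ≤ R i j) {x : m → ℝ} (hx : ∀ i, 0 ≤ x i)
    (hx0 : x ≠ 0) {c : ℝ} (h : ∀ i, c * x i ≤ (R *ᵥ x) i) : c ≤ spectralRad R := by
  rcases le_or_gt c 0 with hc | hc
  · exact hc.trans (spectralRad_nonneg R)
  set A : Matrix m m ℂ := R.map (fun x : ℝ => (x : ℂ)) with hA
  set v : m → ℂ := fun i => (x i : ℂ) with hv
  have hv0 : 0 < ‖v‖ := by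
    rw [norm_pos_iff]
    intro h0
    apply hx0
    funext i
    have := congrFun h0 i
    simpa [hv] using this
  have hApow (k : ℕ) : A ^ k = (R ^ k).map (fun x : ℝ => (x : ℂ)) := by
    have := Matrix.map_pow R Complex.ofRealHom k
    exact this.symm
  have hAv (k : ℕ) (i : m) : (A ^ k *ᵥ v) i = (((R ^ k *ᵥ x) i : ℝ) : ℂ) := by
    rw [hApow]
    simp [mulVec, dotProduct, hv]
  -- Iterating `c x ≤ R x` and taking sup norms bounds all powers; Gelfand's formula then passes to
  -- the spectral radius.
  have key (k : ℕ) : c ^ k ≤ ‖A ^ k‖ := by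
    have h1 : ‖((c ^ k : ℝ) : ℂ) • v‖ ≤ ‖A ^ k *ᵥ v‖ := by
      refine (pi_norm_le_iff_of_nonneg (norm_nonneg _)).2 fun i => ?_
      have h2 : ‖(((c ^ k : ℝ) : ℂ) • v) i‖ = c ^ k * x i := by
        simp only [hv, Pi.smul_apply, smul_eq_mul, norm_mul, Complex.norm_real, Real.norm_eq_abs,
          abs_of_nonneg (hx i), abs_of_nonneg (pow_nonneg hc.le k)]
      rw [h2]
      calc c ^ k * x i ≤ (R ^ k *ᵥ x) i := pow_mul_le_pow_mulVec hR hc.le h k i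
        _ ≤ ‖(A ^ k *ᵥ v) i‖ := by
            rw [hAv, Complex.norm_real]
            exact le_abs_self _
        _ ≤ _ := norm_le_pi_norm _ i
    have h3 : c ^ k * ‖v‖ ≤ ‖A ^ k‖ * ‖v‖ := by
      calc c ^ k * ‖v‖ = ‖((c ^ k : ℝ) : ℂ) • v‖ := by
            rw [norm_smul, Complex.norm_real, Real.norm_of_nonneg (pow_nonneg hc.le k)]
        _ ≤ _ := h1.trans (linfty_opNorm_mulVec _ _)
    exact le_of_mul_le_mul_right h3 hv0
  have hlim := spectrum.pow_nnnorm_pow_one_div_tendsto_nhds_spectralRadius A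
  have hle : ENNReal.ofReal c ≤ spectralRadius ℂ A := by
    refine ge_of_tendsto hlim ?_
    filter_upwards [Filter.eventually_gt_atTop 0] with k hk
    have hk' : (k : ℝ) ≠ 0 := by positivity
    have h4 : ENNReal.ofReal c ^ k ≤ (‖A ^ k‖₊ : ENNReal) := by
      rw [← ENNReal.ofReal_pow hc.le, ← enorm_eq_nnnorm, ← ofReal_norm]
      exact ENNReal.ofReal_le_ofReal (key k)
    calc ENNReal.ofReal c = (ENNReal.ofReal c ^ k) ^ (1 / k : ℝ) := by
          rw [← ENNReal.rpow_natCast, ← ENNReal.rpow_mul, mul_one_div_cancel hk', ENNReal.rpow_one]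
      _ ≤ _ := ENNReal.rpow_le_rpow h4 (by positivity)
  exact (ENNReal.ofReal_le_iff_le_toReal (spectralRadius_matrix_ne_top A)).1 hle

end CollatzWielandt

/-! ### Quadratic forms and total variation -/

open Matrix in
/-- A real symmetric matrix is bounded, as a quadratic form, by any upper bound of its
eigenvalues. -/
theorem dotProduct_mulVec_le_of_eigenvalue_le {m : Type*} [Fintype m] [DecidableEq m]
    {B : Matrix m m ℝ} (hB : B.IsHermitian) {c : ℝ}
    (h : ∀ (b : ℝ) (x : m → ℝ), x ≠ 0 → B *ᵥ x = b • x → b ≤ c) (x : m → ℝ) :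
    x ⬝ᵥ B *ᵥ x ≤ c * (x ⬝ᵥ x) := by
  have hM : (c • (1 : Matrix m m ℝ) - B).IsHermitian := by
    refine IsHermitian.sub ?_ hB
    simp [IsHermitian]
  have hpsd : (c • (1 : Matrix m m ℝ) - B).PosSemidef := by
    rw [hM.posSemidef_iff_eigenvalues_nonneg]
    intro j
    have hj := hM.mulVec_eigenvectorBasis j
    have hne : (⇑(hM.eigenvectorBasis j) : m → ℝ) ≠ 0 := by
      intro h0
      apply hM.eigenvectorBasis.orthonormal.ne_zero j
      ext i
      exact congrFun h0 i
    have := h (c - hM.eigenvalues j) _ hne (by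
      rw [sub_mulVec, smul_mulVec, one_mulVec] at hj
      rw [sub_smul, ← hj]
      simp)
    simpa using this
  have := hpsd.dotProduct_mulVec_nonneg x
  rw [sub_mulVec, smul_mulVec, one_mulVec, dotProduct_sub, dotProduct_smul] at this
  simp only [star_trivial, smul_eq_mul] at this
  linarith

/-- Expectations of a function with values in `[a, b]` under two distributions differ by at most
the total variation distance times `b - a`. -/
theorem sum_sub_mul_le_tvDist {α : Type*} [Fintype α] {p p' g : α → ℝ} {a b : ℝ}
    (hs : ∑ i, p i = ∑ i, p' i) (hg : ∀ i, p i = p' i ∨ (a ≤ g i ∧ g i ≤ b)) :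
    ∑ i, (p i - p' i) * g i ≤ tvDist p p' * (b - a) := by
  -- Equal total masses allow `g` to be recentred at the midpoint, where its modulus is at most half
  -- the range.
  have h0 : ∑ i, (p i - p' i) * ((a + b) / 2) = 0 := by
    rw [← Finset.sum_mul, Finset.sum_sub_distrib, hs, sub_self, zero_mul]
  calc ∑ i, (p i - p' i) * g i
      = ∑ i, (p i - p' i) * (g i - (a + b) / 2) := by
        simp only [mul_sub, Finset.sum_sub_distrib, h0, sub_zero]
    _ ≤ ∑ i, |p i - p' i| * ((b - a) / 2) := by
        refine Finset.sum_le_sum fun i _ => ?_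
        rcases hg i with h | ⟨h1, h2⟩
        · simp [h]
        · refine (le_abs_self _).trans ?_
          rw [abs_mul]
          gcongr
          rw [abs_le]
          constructor <;> linarith
    _ = tvDist p p' * (b - a) := by
        rw [← Finset.sum_mul, tvDist]
        ring

/-! ### The local spectral bound for a finite weighted family of coordinates -/

section Local

variable {Ω κ U : Type*} [Fintype Ω] [DecidableEq κ] [Fintype U]

/-- The total weight times the variance of `f` under the weight `w`. -/
noncomputable def scaledVar (w f : Ω → ℝ) : ℝ :=
  ∑ σ, w σ * f σ ^ 2 - (∑ σ, w σ * f σ) ^ 2 / ∑ σ, w σ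

/-- The sum of `F` over the fibre of `Y` above `c`. -/
noncomputable def fiberSum (Y : Ω → κ) (F : Ω → ℝ) (c : κ) : ℝ :=
  ∑ σ, if Y σ = c then F σ else 0

theorem sum_mul_comp_eq [Fintype κ] (Y : Ω → κ) (F : Ω → ℝ) (g : κ → ℝ) :
    ∑ σ, F σ * g (Y σ) = ∑ c, fiberSum Y F c * g c := by
  simp only [fiberSum, Finset.sum_mul]
  rw [Finset.sum_comm]
  refine Finset.sum_congr rfl fun σ _ => ?_
  simp [ite_mul]

theorem sum_fiberSum [Fintype κ] (Y : Ω → κ) (F : Ω → ℝ) : ∑ c, fiberSum Y F c = ∑ σ, F σ := by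
  simpa using (sum_mul_comp_eq Y F fun _ => 1).symm

theorem fiberSum_nonneg {w : Ω → ℝ} (hw : ∀ σ, 0 ≤ w σ) (Y : Ω → κ) (c : κ) :
    0 ≤ fiberSum Y w c :=
  Finset.sum_nonneg fun σ _ => by split_ifs <;> simp [hw]

theorem le_fiberSum {w : Ω → ℝ} (hw : ∀ σ, 0 ≤ w σ) (Y : Ω → κ) (σ : Ω) :
    w σ ≤ fiberSum Y w (Y σ) := by
  have := Finset.single_le_sum (f := fun τ => if Y τ = Y σ then w τ else 0)
    (fun τ _ => by split_ifs <;> simp [hw]) (Finset.mem_univ σ)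
  simpa [fiberSum] using this

theorem eq_zero_of_fiberSum_eq_zero {w : Ω → ℝ} (hw : ∀ σ, 0 ≤ w σ) {Y : Ω → κ} {c : κ}
    (h : fiberSum Y w c = 0) {σ : Ω} (hσ : Y σ = c) : w σ = 0 :=
  le_antisymm (by rw [← h, ← hσ]; exact le_fiberSum hw Y σ) (hw σ)

theorem fiberSum_eq_zero {F : Ω → ℝ} {Y : Ω → κ} {c : κ} (h : ∀ σ, Y σ = c → F σ = 0) :
    fiberSum Y F c = 0 :=
  Finset.sum_eq_zero fun σ _ => by
    split_ifs with hσ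
    · exact h σ hσ
    · rfl

theorem scaledVar_sub_const {w : Ω → ℝ} (hw : ∀ σ, 0 ≤ w σ) (f : Ω → ℝ) (a : ℝ) :
    scaledVar w (fun σ => f σ - a) = scaledVar w f := by
  rcases eq_or_ne (∑ σ, w σ) 0 with h | h
  · have h0 (σ : Ω) : w σ = 0 :=
      (Finset.sum_eq_zero_iff_of_nonneg fun σ _ => hw σ).1 h σ (Finset.mem_univ σ)
    simp [scaledVar, h0]
  · have h1 : ∑ σ, w σ * (f σ - a) ^ 2
        = ∑ σ, w σ * f σ ^ 2 - 2 * a * ∑ σ, w σ * f σ + a ^ 2 * ∑ σ, w σ := by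
      simp only [Finset.mul_sum, ← Finset.sum_sub_distrib, ← Finset.sum_add_distrib]
      exact Finset.sum_congr rfl fun σ _ => by ring
    have h2 : ∑ σ, w σ * (f σ - a) = ∑ σ, w σ * f σ - a * ∑ σ, w σ := by
      simp only [Finset.mul_sum, ← Finset.sum_sub_distrib]
      exact Finset.sum_congr rfl fun σ _ => by ring
    rw [scaledVar, scaledVar, h1, h2]
    field_simp
    ring

/-- The conditional probabilities `P(Z = c' | Y = c)` under the weight `w`. -/
noncomputable def condFiber (w : Ω → ℝ) (Y : Ω → κ) (c : κ) (Z : Ω → κ) (c' : κ) : ℝ :=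
  fiberSum Z (fun σ => if Y σ = c then w σ else 0) c' / fiberSum Y w c

theorem sum_condFiber [Fintype κ] {w : Ω → ℝ} {Y : Ω → κ} {c : κ} (h : fiberSum Y w c ≠ 0) (Z : Ω → κ) :
    ∑ c', condFiber w Y c Z c' = 1 := by
  simp only [condFiber, ← Finset.sum_div, sum_fiberSum]
  exact div_self h

/-- Null values of `Z` stay null after conditioning, so the arbitrary value of a conditional
expectation there never matters. -/
theorem condFiber_eq_zero {w : Ω → ℝ} (hw : ∀ σ, 0 ≤ w σ) {Y : Ω → κ} {c : κ} {Z : Ω → κ} {c' : κ}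
    (h : fiberSum Z w c' = 0) : condFiber w Y c Z c' = 0 := by
  rw [condFiber, fiberSum_eq_zero, zero_div]
  intro σ hσ
  simp [eq_zero_of_fiberSum_eq_zero hw h hσ]

theorem condFiber_self {w : Ω → ℝ} {Y : Ω → κ} {c : κ} (h : fiberSum Y w c ≠ 0) (c' : κ) :
    condFiber w Y c Y c' = if c' = c then 1 else 0 := by
  split_ifs with hc
  · subst hc
    rw [condFiber, div_eq_one_iff_eq h]
    exact Finset.sum_congr rfl fun σ _ => by by_cases hσ : Y σ = c' <;> simp [hσ]
  · rw [condFiber, fiberSum_eq_zero, zero_div]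
    intro σ hσ
    rw [if_neg]
    rw [hσ]
    exact hc

/-- The matrix of the quadratic form `f ↦ ∑ᵤ Var(E[f | Xᵤ])` in the variables `√w f`. -/
noncomputable def projMatrix (w : Ω → ℝ) (X : U → Ω → κ) : Matrix Ω Ω ℝ := fun σ τ =>
  √(w σ) * √(w τ) * ∑ u, ((if X u τ = X u σ then (fiberSum (X u) w (X u σ))⁻¹ else 0)
    - (∑ ρ, w ρ)⁻¹)

theorem projMatrix_isHermitian (w : Ω → ℝ) (X : U → Ω → κ) : (projMatrix w X).IsHermitian := by
  ext σ τ
  simp only [projMatrix, Matrix.conjTranspose_apply, star_trivial]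
  rw [mul_comm (√(w τ))]
  congr 1
  refine Finset.sum_congr rfl fun u _ => ?_
  by_cases h : X u τ = X u σ
  · simp [h]
  · simp [h, Ne.symm h]

open Matrix in
theorem projMatrix_mulVec (w : Ω → ℝ) (X : U → Ω → κ) (h : Ω → ℝ) (σ : Ω) :
    (projMatrix w X *ᵥ h) σ = √(w σ) * ∑ u,
      (fiberSum (X u) (fun τ => √(w τ) * h τ) (X u σ) / fiberSum (X u) w (X u σ)
        - (∑ τ, √(w τ) * h τ) / ∑ τ, w τ) := by
  simp only [mulVec, dotProduct, projMatrix, Finset.mul_sum, Finset.sum_mul]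
  rw [Finset.sum_comm]
  refine Finset.sum_congr rfl fun u _ => ?_
  simp only [fiberSum, div_eq_mul_inv, Finset.sum_mul, ← Finset.sum_sub_distrib, Finset.mul_sum]
  refine Finset.sum_congr rfl fun τ _ => ?_
  split_ifs <;> ring

/-- Eigenvalues of `projMatrix` exceed one by at most the spectral radius of any matrix that
dominates the pairwise influences. -/
theorem eigenvalue_projMatrix_le [Fintype κ] [DecidableEq U] {w : Ω → ℝ} (hw : ∀ σ, 0 ≤ w σ)
    (hW : 0 < ∑ σ, w σ) (X : U → Ω → κ) {R : Matrix U U ℝ} (hR : ∀ u v, 0 ≤ R u v)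
    (hinf : ∀ u v, u ≠ v → ∀ c c', 0 < fiberSum (X u) w c → 0 < fiberSum (X u) w c' →
      tvDist (condFiber w (X u) c (X v)) (condFiber w (X u) c' (X v)) ≤ R u v)
    {b : ℝ} {h : Ω → ℝ} (h0 : h ≠ 0) (hb : (projMatrix w X).mulVec h = b • h) :
    b ≤ 1 + spectralRad R := by
  -- The negation is used to know that `b > 0`, so that `b` can be cancelled.
  by_contra! hlt
  have hρ := spectralRad_nonneg R
  have hb0 : 0 < b := by linarith
  set a : U → κ → ℝ := fun u => fiberSum (X u) (fun τ => √(w τ) * h τ) with ha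
  set W : U → κ → ℝ := fun u => fiberSum (X u) w with hWdef
  have heig (σ : Ω) : b * h σ = √(w σ) * ∑ u, (a u (X u σ) / W u (X u σ)
      - (∑ τ, √(w τ) * h τ) / ∑ τ, w τ) := by
    rw [← projMatrix_mulVec, hb, Pi.smul_apply, smul_eq_mul]
  have ha0 (u : U) (c : κ) (hc : W u c = 0) : a u c = 0 :=
    fiberSum_eq_zero fun σ hσ => by simp [eq_zero_of_fiberSum_eq_zero hw hc hσ]
  have hWa (u : U) (c : κ) : W u c * (a u c / W u c) = a u c := by
    rcases eq_or_ne (W u c) 0 with hc | hc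
    · rw [hc, ha0 u c hc, zero_mul]
    · exact mul_div_cancel₀ _ hc
  have hsumW (u : U) : ∑ c, W u c = ∑ σ, w σ := sum_fiberSum _ _
  have hsuma (u : U) : ∑ c, a u c = ∑ τ, √(w τ) * h τ := sum_fiberSum _ _
  have heig' (σ : Ω) : b * (√(w σ) * h σ) = w σ * ∑ u, (a u (X u σ) / W u (X u σ)
      - (∑ τ, √(w τ) * h τ) / ∑ τ, w τ) := by
    calc b * (√(w σ) * h σ) = √(w σ) * (b * h σ) := by ring
      _ = _ := by rw [heig, ← mul_assoc, Real.mul_self_sqrt (hw σ)]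
  -- Integrating the eigenvalue equation kills its right side, because each `E[f | Xᵤ] - E f` has
  -- mean zero.
  have hA : ∑ τ, √(w τ) * h τ = 0 := by
    have : b * ∑ τ, √(w τ) * h τ = 0 := by
      rw [Finset.mul_sum, Finset.sum_congr rfl fun σ _ => heig' σ]
      simp only [Finset.mul_sum]
      rw [Finset.sum_comm]
      refine Finset.sum_eq_zero fun u _ => ?_
      rw [sum_mul_comp_eq (X u) w fun c => a u c / W u c - (∑ τ, √(w τ) * h τ) / ∑ τ, w τ]
      simp only [mul_sub, Finset.sum_sub_distrib]
      have := hWa u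
      simp only [hWdef] at this
      rw [Finset.sum_congr rfl fun c _ => this c, hsuma, ← Finset.sum_mul, sum_fiberSum,
        mul_div_cancel₀ _ hW.ne', sub_self]
    exact (mul_eq_zero.1 this).resolve_left hb0.ne'
  set G : U → κ → ℝ := fun u c => a u c / W u c with hG
  simp only [hA, zero_div, sub_zero] at heig heig'
  have hmean (u : U) : ∑ c, W u c * G u c = 0 := by
    rw [Finset.sum_congr rfl fun c _ => hWa u c, hsuma, hA]
  -- With mean zero, `b` times the eigenfunction is `∑ᵥ Gᵥ(Xᵥ)`; this is its expectation given `Xᵤ =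
  -- c`.
  have hstep (u : U) (c : κ) (hc : 0 < W u c) :
      b * G u c = ∑ v, ∑ c', condFiber w (X u) c (X v) c' * G v c' := by
    have h1 : b * a u c = ∑ v, ∑ c',
        fiberSum (X v) (fun σ => if X u σ = c then w σ else 0) c' * G v c' := by
      rw [Finset.sum_congr rfl fun v _ => (sum_mul_comp_eq (X v)
        (fun σ => if X u σ = c then w σ else 0) (G v)).symm, Finset.sum_comm]
      simp only [ha, fiberSum, Finset.mul_sum]
      refine Finset.sum_congr rfl fun σ _ => ?_
      rw [← Finset.mul_sum]
      split_ifs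
      · exact heig' σ
      · simp
    simp only [hG, condFiber]
    rw [mul_div_assoc', h1, Finset.sum_div]
    refine Finset.sum_congr rfl fun v _ => ?_
    rw [Finset.sum_div]
    refine Finset.sum_congr rfl fun c' _ => ?_
    ring
  have hvals (u : U) : (Finset.univ.filter fun c => 0 < W u c).Nonempty := by
    by_contra hne
    rw [Finset.not_nonempty_iff_eq_empty, Finset.filter_eq_empty_iff] at hne
    have : ∑ c, W u c ≤ 0 := Finset.sum_nonpos fun c hc => not_lt.1 (hne hc)
    rw [hsumW] at this
    linarith
  -- Extremes are taken only over values of positive weight: elsewhere `G` is the meaningless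
  -- quotient by zero, and the influence hypothesis says nothing.
  choose M hM hMmax using fun u => Finset.exists_max_image _ (G u) (hvals u)
  choose m hm hmmin using fun u => Finset.exists_min_image _ (G u) (hvals u)
  simp only [Finset.mem_filter, Finset.mem_univ, true_and] at hM hMmax hm hmmin
  -- If all oscillations vanished, each `Gᵤ` would be constant with mean zero, hence zero where it
  -- counts, and the eigenvalue equation would give `h = 0`.
  have hosc : (fun u => G u (M u) - G u (m u)) ≠ 0 := by
    intro hz
    apply h0
    have hGz (u : U) (c : κ) (hc : 0 < W u c) : G u c = 0 := by
      have hz' : G u (M u) - G u (m u) = 0 := congrFun hz u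
      have hconst (c : κ) (hc : 0 < W u c) : G u c = G u (m u) :=
        le_antisymm (by linarith [hMmax u c hc]) (hmmin u c hc)
      have h2 : ∑ c, W u c * G u c = (∑ c, W u c) * G u (m u) := by
        rw [Finset.sum_mul]
        refine Finset.sum_congr rfl fun c _ => ?_
        rcases (fiberSum_nonneg hw (X u) c).eq_or_lt with hc | hc
        · have : W u c = 0 := hc.symm
          simp [this]
        · rw [hconst c hc]
      rw [hmean, hsumW] at h2
      rw [hconst c hc]
      exact (mul_eq_zero.1 h2.symm).resolve_left hW.ne'
    funext σ
    have h3 : b * h σ = 0 := by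
      rw [heig]
      rcases (hw σ).eq_or_lt with hσ | hσ
      · simp [← hσ]
      · rw [Finset.sum_eq_zero, mul_zero]
        intro u _
        exact hGz u _ (hσ.trans_le (le_fiberSum hw (X u) σ))
    exact (mul_eq_zero.1 h3).resolve_left hb0.ne'
  have hle := le_spectralRad_of_mul_le_mulVec hR (x := fun u => G u (M u) - G u (m u))
    (fun u => sub_nonneg.2 (hMmax u _ (hm u))) hosc (c := b - 1) (by
      intro u
      -- The term `v = u` reproduces the oscillation of `Gᵤ`; moving it to the left turns `b` into
      -- `b - 1`.
      have h4 : (b - 1) * (G u (M u) - G u (m u)) = ∑ v, if v = u then 0 else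
          ∑ c', (condFiber w (X u) (M u) (X v) c' - condFiber w (X u) (m u) (X v) c') * G v c' := by
        have h5 : ∑ v, ∑ c', (condFiber w (X u) (M u) (X v) c'
            - condFiber w (X u) (m u) (X v) c') * G v c' = b * (G u (M u) - G u (m u)) := by
          rw [mul_sub, hstep u _ (hM u), hstep u _ (hm u)]
          simp only [sub_mul, Finset.sum_sub_distrib]
        have h6 : ∑ c', (condFiber w (X u) (M u) (X u) c'
            - condFiber w (X u) (m u) (X u) c') * G u c' = G u (M u) - G u (m u) := by
          simp [condFiber_self (hM u).ne', condFiber_self (hm u).ne', sub_mul,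
            Finset.sum_sub_distrib]
        rw [← Finset.add_sum_erase _ _ (Finset.mem_univ u), h6] at h5
        rw [← Finset.add_sum_erase _ _ (Finset.mem_univ u), if_pos rfl, zero_add,
          Finset.sum_congr rfl fun v hv => if_neg (Finset.ne_of_mem_erase hv)]
        linarith
      rw [h4]
      refine Finset.sum_le_sum fun v _ => ?_
      have hx : 0 ≤ G v (M v) - G v (m v) := sub_nonneg.2 (hMmax v _ (hm v))
      split_ifs with huv
      · exact mul_nonneg (hR u v) hx
      · refine (sum_sub_mul_le_tvDist (a := G v (m v)) (b := G v (M v)) ?_ ?_).trans ?_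
        · rw [sum_condFiber (hM u).ne', sum_condFiber (hm u).ne']
        · intro c'
          rcases (fiberSum_nonneg hw (X v) c').eq_or_lt with hc | hc
          · left
            rw [condFiber_eq_zero hw hc.symm, condFiber_eq_zero hw hc.symm]
          · exact Or.inr ⟨hmmin v c' hc, hMmax v c' hc⟩
        · exact mul_le_mul_of_nonneg_right
            (hinf u v (Ne.symm huv) _ _ (hM u) (hm u)) hx)
  linarith

/-- If the influences are dominated by `R`, then conditioning on a uniformly random coordinate
keeps most of the variance. -/
theorem mul_scaledVar_le_sum_scaledVar [Fintype κ] [DecidableEq U] {w : Ω → ℝ} (hw : ∀ σ, 0 ≤ w σ)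
    (hW : 0 < ∑ σ, w σ) (X : U → Ω → κ) {R : Matrix U U ℝ} (hR : ∀ u v, 0 ≤ R u v)
    (hinf : ∀ u v, u ≠ v → ∀ c c', 0 < fiberSum (X u) w c → 0 < fiberSum (X u) w c' →
      tvDist (condFiber w (X u) c (X v)) (condFiber w (X u) c' (X v)) ≤ R u v)
    (f : Ω → ℝ) :
    (Fintype.card U - 1 - spectralRad R) * scaledVar w f ≤
      ∑ u, ∑ c, scaledVar (fun σ => if X u σ = c then w σ else 0) f := by
  classical
  have hwc (u : U) (c : κ) (σ : Ω) : 0 ≤ if X u σ = c then w σ else 0 := by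
    split_ifs <;> simp [hw]
  set μf := (∑ σ, w σ * f σ) / ∑ σ, w σ with hμf
  rw [← scaledVar_sub_const hw f μf, Finset.sum_congr rfl fun u _ =>
    Finset.sum_congr rfl fun c _ => (scaledVar_sub_const (hwc u c) f μf).symm]
  set f₀ : Ω → ℝ := fun σ => f σ - μf with hf₀
  have hmean : ∑ σ, w σ * f₀ σ = 0 := by
    simp only [hf₀, mul_sub, Finset.sum_sub_distrib, ← Finset.sum_mul]
    rw [hμf, mul_div_cancel₀ _ hW.ne', sub_self]
  have hvar : scaledVar w f₀ = ∑ σ, w σ * f₀ σ ^ 2 := by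
    rw [scaledVar, hmean]
    simp
  have hq := dotProduct_mulVec_le_of_eigenvalue_le (projMatrix_isHermitian w X)
    (fun b x hx0 hx => eigenvalue_projMatrix_le hw hW X hR hinf hx0 hx) (fun σ => √(w σ) * f₀ σ)
  have hsq (σ : Ω) (t : ℝ) : √(w σ) * (√(w σ) * t) = w σ * t := by
    rw [← mul_assoc, Real.mul_self_sqrt (hw σ)]
  have h1 : (fun σ => √(w σ) * f₀ σ) ⬝ᵥ (fun σ => √(w σ) * f₀ σ) = ∑ σ, w σ * f₀ σ ^ 2 := by
    refine Finset.sum_congr rfl fun σ _ => ?_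
    calc √(w σ) * f₀ σ * (√(w σ) * f₀ σ) = √(w σ) * (√(w σ) * f₀ σ ^ 2) := by ring
      _ = _ := hsq _ _
  have h2 : (fun σ => √(w σ) * f₀ σ) ⬝ᵥ (projMatrix w X).mulVec (fun σ => √(w σ) * f₀ σ)
      = ∑ u, ∑ c, fiberSum (X u) (fun σ => w σ * f₀ σ) c ^ 2 / fiberSum (X u) w c := by
    have h3 (σ : Ω) : √(w σ) * f₀ σ * (projMatrix w X).mulVec (fun σ => √(w σ) * f₀ σ) σ
        = ∑ u, w σ * f₀ σ *
          (fiberSum (X u) (fun σ => w σ * f₀ σ) (X u σ) / fiberSum (X u) w (X u σ)) := by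
      rw [projMatrix_mulVec]
      simp only [hsq, hmean, zero_div, sub_zero]
      rw [← Finset.mul_sum, ← hsq σ (f₀ σ)]
      ring
    rw [dotProduct, Finset.sum_congr rfl fun σ _ => h3 σ, Finset.sum_comm]
    refine Finset.sum_congr rfl fun u _ => ?_
    rw [sum_mul_comp_eq (X u) (fun σ => w σ * f₀ σ) fun c =>
      fiberSum (X u) (fun σ => w σ * f₀ σ) c / fiberSum (X u) w c]
    exact Finset.sum_congr rfl fun c _ => by ring
  -- Law of total variance for a centred function: the mean conditional variance is the second
  -- moment minus that of `E[f₀ | Xᵤ]`.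
  have h4 (u : U) : ∑ c, scaledVar (fun σ => if X u σ = c then w σ else 0) f₀
      = ∑ σ, w σ * f₀ σ ^ 2
        - ∑ c, fiberSum (X u) (fun σ => w σ * f₀ σ) c ^ 2 / fiberSum (X u) w c := by
    simp only [scaledVar, Finset.sum_sub_distrib, ite_mul, zero_mul]
    congr 1
    exact sum_fiberSum (X u) fun σ => w σ * f₀ σ ^ 2
  rw [Finset.sum_congr rfl fun u _ => h4 u, Finset.sum_sub_distrib, ← h2, hvar]
  rw [h1] at hq
  simp only [Finset.sum_const, Finset.card_univ, nsmul_eq_mul]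
  linarith

end Local

/-! ### Pinning and approximate tensorisation of variance -/

section Pinning

theorem tvDist_nonneg {α : Type*} [Fintype α] (f g : α → ℝ) : 0 ≤ tvDist f g :=
  mul_nonneg (by norm_num) (Finset.sum_nonneg fun _ _ => abs_nonneg _)

theorem scaledVar_nonneg {Ω : Type*} [Fintype Ω] {w : Ω → ℝ} (hw : ∀ σ, 0 ≤ w σ) (f : Ω → ℝ) :
    0 ≤ scaledVar w f := by
  rcases eq_or_ne (∑ σ, w σ) 0 with h | h
  · have h0 (σ : Ω) : w σ = 0 :=
      (Finset.sum_eq_zero_iff_of_nonneg fun σ _ => hw σ).1 h σ (Finset.mem_univ σ)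
    simp [scaledVar, h0]
  · rw [← scaledVar_sub_const hw f ((∑ σ, w σ * f σ) / ∑ σ, w σ), scaledVar]
    have : ∑ σ, w σ * (f σ - (∑ σ, w σ * f σ) / ∑ σ, w σ) = 0 := by
      simp only [mul_sub, Finset.sum_sub_distrib, ← Finset.sum_mul]
      rw [mul_div_cancel₀ _ h, sub_self]
    rw [this]
    simpa using Finset.sum_nonneg fun σ _ => mul_nonneg (hw σ) (sq_nonneg _)

variable {V : Type*} {q : ℕ}

/-- The configurations that agree with `τ` on `Λ`. -/
def agreeOn (Λ : Finset V) (τ : V → Fin q) : Set (V → Fin q) := {ρ | ∀ v ∈ Λ, ρ v = τ v}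

/-- The configurations that agree with `σ` outside `v`. -/
def agreeOff (v : V) (σ : V → Fin q) : Set (V → Fin q) := {ρ | ∀ w, w ≠ v → ρ w = σ w}

theorem cylinder_eq_agreeOn (Λ : Finset V) (τ : V → Fin q) :
    cylinder Λ (fun v => τ v) = agreeOn Λ τ := by
  ext ρ
  simp [cylinder, agreeOn]

theorem agreeOn_inter [DecidableEq V] {Λ : Finset V} {u : V} (hu : u ∉ Λ) (τ : V → Fin q) (c : Fin q) :
    {ρ | ρ u = c} ∩ agreeOn Λ τ = agreeOn (insert u Λ) (Function.update τ u c) := by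
  ext ρ
  simp only [agreeOn, Set.mem_inter_iff, Set.mem_ofPred_eq, Finset.mem_insert, forall_eq_or_imp,
    Function.update_self]
  refine and_congr_right fun _ => forall₂_congr fun v hv => ?_
  rw [Function.update_of_ne]
  rintro rfl
  exact hu hv

theorem ite_indicator_eq (μ : (V → Fin q) → ℝ) (E : Set (V → Fin q)) (u : V) (c : Fin q) :
    (fun σ => if σ u = c then E.indicator μ σ else 0) = ({ρ | ρ u = c} ∩ E).indicator μ := by
  classical
  funext σ
  by_cases h1 : σ u = c <;> simp [Set.indicator_apply, h1]

variable [Fintype V] [DecidableEq V]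

theorem agreeOff_eq_agreeOn {Λ : Finset V} {v : V} (hv : Λᶜ = {v}) {τ σ : V → Fin q}
    (hσ : σ ∈ agreeOn Λ τ) : agreeOff v σ = agreeOn Λ τ := by
  have hmem (w : V) : w ≠ v ↔ w ∈ Λ := by
    rw [Ne, ← Finset.mem_singleton, ← hv, Finset.mem_compl, not_not]
  ext ρ
  simp only [agreeOff, agreeOn, Set.mem_ofPred_eq, hmem]
  exact forall₂_congr fun w hw => by rw [hσ w hw]

/-- The conditional expectation of `f` given the values of all vertices other than `v`. -/
noncomputable def siteAvg (μ : (V → Fin q) → ℝ) (v : V) (f : (V → Fin q) → ℝ)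
    (σ : V → Fin q) : ℝ :=
  (∑ ρ, (agreeOff v σ).indicator (fun ρ => μ ρ * f ρ) ρ) / prob μ (agreeOff v σ)

/-- The contribution of the event `E` to the Dirichlet form of the resampling of `v`. -/
noncomputable def siteForm (μ : (V → Fin q) → ℝ) (v : V) (E : Set (V → Fin q))
    (f : (V → Fin q) → ℝ) : ℝ :=
  ∑ σ, E.indicator μ σ * (f σ * (f σ - siteAvg μ v f σ))

/-- `siteAvg` does not depend on `E`, so the form is additive over a partition of the event. This
lets the pinned forms reassemble in the induction on free sites. -/
theorem sum_siteForm_inter (μ : (V → Fin q) → ℝ) (v : V) (E : Set (V → Fin q)) (u : V)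
    (f : (V → Fin q) → ℝ) :
    ∑ c, siteForm μ v ({ρ | ρ u = c} ∩ E) f = siteForm μ v E f := by
  simp only [siteForm, ← ite_indicator_eq]
  rw [Finset.sum_comm]
  simp [ite_mul]

theorem fiberSum_eq_prob (μ : (V → Fin q) → ℝ) (E : Set (V → Fin q)) (u : V) (c : Fin q) :
    fiberSum (fun σ : V → Fin q => σ u) (E.indicator μ) c = prob μ (E ∩ {τ | τ u = c}) := by
  rw [Set.inter_comm, prob, ← ite_indicator_eq]
  rfl

theorem condFiber_eq_pinnedMarginal (μ : (V → Fin q) → ℝ) (Λ : Finset V) (σ : Λ → Fin q)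
    (u v : V) (c : Fin q) :
    condFiber ((cylinder Λ σ).indicator μ) (fun τ => τ u) c (fun τ => τ v)
      = pinnedMarginal μ Λ σ u c v := by
  funext c'
  rw [condFiber, ite_indicator_eq, fiberSum_eq_prob, fiberSum_eq_prob, pinnedMarginal,
    condMarginal, Set.inter_comm {ρ : V → Fin q | ρ u = c}]

theorem influenceMatrix_nonneg (μ : (V → Fin q) → ℝ) (Λ : Finset V) (σ : Λ → Fin q)
    (u v : {v // v ∉ Λ}) : 0 ≤ influenceMatrix μ Λ σ u v := by
  rw [influenceMatrix]
  split_ifs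
  · rfl
  · exact Real.iSup_nonneg fun _ => tvDist_nonneg _ _

theorem tvDist_le_influenceMatrix {μ : (V → Fin q) → ℝ} {Λ : Finset V} {σ : Λ → Fin q}
    {u v : {v // v ∉ Λ}} (huv : u ≠ v) {c c' : Fin q} (hc : c ∈ possibleValues μ Λ σ u)
    (hc' : c' ∈ possibleValues μ Λ σ u) :
    tvDist (pinnedMarginal μ Λ σ u c v) (pinnedMarginal μ Λ σ u c' v)
      ≤ influenceMatrix μ Λ σ u v := by
  rw [influenceMatrix, if_neg huv]
  exact le_ciSup (f := fun p : possibleValues μ Λ σ u × possibleValues μ Λ σ u =>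
    tvDist (pinnedMarginal μ Λ σ u p.1 v) (pinnedMarginal μ Λ σ u p.2 v))
    (Set.finite_range _).bddAbove (⟨c, hc⟩, ⟨c', hc'⟩)

theorem indicator_eq_zero_of_prob_eq_zero {μ : (V → Fin q) → ℝ} (hμ : ∀ σ, 0 ≤ μ σ)
    {E : Set (V → Fin q)} (h : prob μ E = 0) (σ : V → Fin q) : E.indicator μ σ = 0 :=
  (Finset.sum_eq_zero_iff_of_nonneg fun σ _ => Set.indicator_nonneg (fun σ _ => hμ σ) σ).1 h σ
    (Finset.mem_univ σ)

/-- Local variance decay for the distribution pinned on `Λ`. -/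
theorem mul_scaledVar_agreeOn_le {μ : (V → Fin q) → ℝ} (hμ : ∀ σ, 0 ≤ μ σ) {C η : ℝ}
    (hSI : SpectrallyIndependent μ C η) {Λ : Finset V} {m : ℕ}
    (hm : Λ.card + m + 2 = Fintype.card V) (τ : V → Fin q) (f : (V → Fin q) → ℝ) :
    (m + 1) * (1 - min η (C / (m + 1))) * scaledVar ((agreeOn Λ τ).indicator μ) f ≤
      ∑ u ∈ Λᶜ, ∑ c, scaledVar ((agreeOn (insert u Λ) (Function.update τ u c)).indicator μ) f := by
  have hind (E : Set (V → Fin q)) (σ : V → Fin q) : 0 ≤ E.indicator μ σ :=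
    Set.indicator_nonneg (fun σ _ => hμ σ) σ
  have hrhs : 0 ≤ ∑ u ∈ Λᶜ, ∑ c,
      scaledVar ((agreeOn (insert u Λ) (Function.update τ u c)).indicator μ) f :=
    Finset.sum_nonneg fun u _ => Finset.sum_nonneg fun c _ => scaledVar_nonneg (hind _) f
  have hprob : 0 ≤ prob μ (agreeOn Λ τ) := Finset.sum_nonneg fun σ _ => hind _ σ
  -- A pinning of mass zero has unnormalised variance zero, so infeasible ones need no separate
  -- treatment in the induction.
  rcases hprob.eq_or_lt with h0 | hW
  · have h1 : scaledVar ((agreeOn Λ τ).indicator μ) f = 0 := by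
      simp [scaledVar, indicator_eq_zero_of_prob_eq_zero hμ h0.symm]
    rw [h1, mul_zero]
    exact hrhs
  · have hfeas : Feasible μ Λ (fun v => τ v) := by
      obtain ⟨ρ, -, hρ⟩ := Finset.exists_lt_of_sum_lt (s := Finset.univ) (f := fun _ => (0 : ℝ))
        (g := (agreeOn Λ τ).indicator μ) (by simpa [prob] using hW)
      have hmem : ρ ∈ agreeOn Λ τ := Set.mem_of_indicator_ne_zero hρ.ne'
      refine ⟨ρ, by rwa [cylinder_eq_agreeOn], ?_⟩
      rwa [Set.indicator_of_mem hmem] at hρ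
    obtain ⟨hρC, hρη⟩ := hSI Λ (by omega) _ hfeas
    set ρ := spectralRad (influenceMatrix μ Λ fun v => τ v) with hρdef
    have hcard : (Fintype.card V : ℝ) = Λ.card + m + 2 := by exact_mod_cast hm.symm
    have hm1 : (0 : ℝ) < m + 1 := by positivity
    have hmin : ρ / (m + 1) ≤ min η (C / (m + 1)) := by
      refine le_min ?_ (by gcongr)
      rwa [hcard, show (Λ.card + m + 2 - Λ.card - 1 : ℝ) = m + 1 by ring] at hρη
    have hU : (Fintype.card {v // v ∉ Λ} : ℝ) = m + 2 := by
      have : Fintype.card {v // v ∉ Λ} = m + 2 := by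
        rw [Fintype.card_subtype_compl, Fintype.card_coe]
        omega
      rw [this]
      push_cast
      ring
    have hloc := mul_scaledVar_le_sum_scaledVar (hind (agreeOn Λ τ)) hW
      (fun (u : {v // v ∉ Λ}) σ => σ u.1) (influenceMatrix_nonneg μ Λ fun v => τ v)
      (by
        intro u v huv c c' hc hc'
        rw [fiberSum_eq_prob] at hc hc'
        rw [← cylinder_eq_agreeOn] at hc hc' hW ⊢
        rw [condFiber_eq_pinnedMarginal, condFiber_eq_pinnedMarginal]
        exact tvDist_le_influenceMatrix huv (div_pos hc hW) (div_pos hc' hW)) f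
    rw [hU, ← hρdef] at hloc
    have hsum : ∑ u : {v // v ∉ Λ}, ∑ c,
        scaledVar (fun σ => if σ u.1 = c then (agreeOn Λ τ).indicator μ σ else 0) f
        = ∑ u ∈ Λᶜ, ∑ c,
          scaledVar ((agreeOn (insert u Λ) (Function.update τ u c)).indicator μ) f := by
      rw [← Finset.sum_coe_sort (s := Λᶜ)]
      refine Fintype.sum_equiv (Equiv.subtypeEquivRight fun v => by simp) _ _ fun u => ?_
      refine Finset.sum_congr rfl fun c _ => ?_
      rw [ite_indicator_eq, agreeOn_inter u.2]
      rfl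
    rw [← hsum]
    refine le_trans (mul_le_mul_of_nonneg_right ?_ (scaledVar_nonneg (hind _) f)) hloc
    -- Here `m + 2` sites are free, and `m + 1` is the denominator `n - |Λ| - 1` of spectral
    -- independence.
    have : (m + 1 : ℝ) * (1 - ρ / (m + 1)) = m + 2 - 1 - ρ := by
      field_simp
      ring
    rw [← this]
    gcongr

/-- A spectrally independent distribution satisfies approximate tensorisation of the variance. -/
theorem scaledVar_agreeOn_le {μ : (V → Fin q) → ℝ} (hμ : ∀ σ, 0 ≤ μ σ) {C η : ℝ}
    (hη1 : η < 1) (hSI : SpectrallyIndependent μ C η) (f : (V → Fin q) → ℝ) (m : ℕ) :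
    ∀ Λ : Finset V, Λ.card + m + 1 = Fintype.card V → ∀ τ : V → Fin q,
      scaledVar ((agreeOn Λ τ).indicator μ) f ≤
        (∏ j ∈ Finset.range m, (1 - min η (C / (j + 1))))⁻¹ *
          ∑ v ∈ Λᶜ, siteForm μ v (agreeOn Λ τ) f := by
  induction m with
  | zero =>
    intro Λ hΛ τ
    have hc : Λᶜ.card = 1 := by
      rw [Finset.card_compl]
      omega
    obtain ⟨v, hv⟩ := Finset.card_eq_one.1 hc
    rw [hv, Finset.sum_singleton, Finset.prod_range_zero, inv_one, one_mul]
    -- With one free site, averaging over it is averaging over the whole pinned distribution, so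
    -- variance and site form coincide.
    apply le_of_eq
    set w := (agreeOn Λ τ).indicator μ with hw
    have havg (σ : V → Fin q) :
        w σ * (f σ * (f σ - siteAvg μ v f σ))
          = w σ * f σ ^ 2 - w σ * f σ * ((∑ ρ, w ρ * f ρ) / ∑ ρ, w ρ) := by
      by_cases hσ : σ ∈ agreeOn Λ τ
      · have : siteAvg μ v f σ = (∑ ρ, w ρ * f ρ) / ∑ ρ, w ρ := by
          rw [siteAvg, agreeOff_eq_agreeOn hv hσ, prob]
          congr 1
          exact Finset.sum_congr rfl fun ρ _ => Set.indicator_mul_left _ _ _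
        rw [this]
        ring
      · simp [hw, Set.indicator_of_notMem hσ]
    rw [siteForm, scaledVar, Finset.sum_congr rfl fun σ _ => havg σ, Finset.sum_sub_distrib,
      ← Finset.sum_mul]
    ring
  | succ m ih =>
    intro Λ hΛ τ
    set K := (∏ j ∈ Finset.range m, (1 - min η (C / (j + 1))))⁻¹ with hK
    have hloc := mul_scaledVar_agreeOn_le hμ hSI (Λ := Λ) (m := m) (by omega) τ f
    set S := ∑ v ∈ Λᶜ, siteForm μ v (agreeOn Λ τ) f with hS
    have hκ : 0 < 1 - min η (C / (m + 1)) := by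
      have := min_le_left η (C / (m + 1))
      linarith
    have hu (u : V) (hu : u ∈ Λᶜ) : ∑ c,
        scaledVar ((agreeOn (insert u Λ) (Function.update τ u c)).indicator μ) f
          ≤ K * (S - siteForm μ u (agreeOn Λ τ) f) := by
      have hu' : u ∉ Λ := Finset.mem_compl.1 hu
      calc _ ≤ ∑ c, K * ∑ v ∈ (insert u Λ)ᶜ,
            siteForm μ v (agreeOn (insert u Λ) (Function.update τ u c)) f :=
            Finset.sum_le_sum fun c _ => ih _ (by rw [Finset.card_insert_of_notMem hu']; omega) _
        _ = K * ∑ v ∈ (insert u Λ)ᶜ, siteForm μ v (agreeOn Λ τ) f := by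
            rw [← Finset.mul_sum, Finset.sum_comm]
            congr 1
            refine Finset.sum_congr rfl fun v _ => ?_
            simp only [← agreeOn_inter hu']
            exact sum_siteForm_inter _ _ _ _ _
        _ = _ := by
            rw [Finset.compl_insert, hS, ← Finset.add_sum_erase _ _ hu]
            ring
    have hcard : (Λᶜ.card : ℝ) = m + 2 := by
      have : Λᶜ.card = m + 2 := by
        rw [Finset.card_compl]
        omega
      rw [this]
      push_cast
      ring
    -- Each site's form survives the pinning of every other free site, hence is counted `m + 1`
    -- times; this cancels the factor on the left.
    have hall : (m + 1) * (1 - min η (C / (m + 1))) * scaledVar ((agreeOn Λ τ).indicator μ) f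
        ≤ (m + 1) * (K * S) := by
      refine hloc.trans ((Finset.sum_le_sum hu).trans (le_of_eq ?_))
      rw [← Finset.mul_sum, Finset.sum_sub_distrib, Finset.sum_const, ← hS, nsmul_eq_mul, hcard]
      ring
    rw [mul_assoc] at hall
    have hall' := le_of_mul_le_mul_left hall (by positivity)
    rw [Finset.prod_range_succ, mul_inv, ← hK, mul_right_comm, ← div_eq_mul_inv, le_div_iff₀ hκ]
    linarith

end Pinning

/-! ### Convergence of positive reversible chains -/

section ReversibleChain

variable {S : Type*} [Fintype S]

open Matrix

theorem sum_mul_mulVec_comm {π : S → ℝ} {P : Matrix S S ℝ}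
    (hrev : ∀ σ τ, π σ * P σ τ = π τ * P τ σ) (f g : S → ℝ) :
    ∑ σ, π σ * f σ * (P *ᵥ g) σ = ∑ σ, π σ * g σ * (P *ᵥ f) σ := by
  simp only [mulVec, dotProduct, Finset.mul_sum]
  rw [Finset.sum_comm]
  refine Finset.sum_congr rfl fun τ _ => Finset.sum_congr rfl fun σ _ => ?_
  linear_combination f σ * g τ * hrev σ τ

theorem sum_mul_mulVec_eq {π : S → ℝ} {P : Matrix S S ℝ}
    (hrev : ∀ σ τ, π σ * P σ τ = π τ * P τ σ) (hP : ∀ σ, ∑ τ, P σ τ = 1) (f : S → ℝ) :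
    ∑ σ, π σ * (P *ᵥ f) σ = ∑ σ, π σ * f σ := by
  have := sum_mul_mulVec_comm hrev (fun _ => 1) f
  simpa [mulVec, dotProduct, hP] using this

/-- The Cauchy–Schwarz inequality for the form `⟨f, P g⟩` of a positive reversible chain. -/
theorem sum_mul_mulVec_sq_le {π : S → ℝ} {P : Matrix S S ℝ}
    (hrev : ∀ σ τ, π σ * P σ τ = π τ * P τ σ)
    (hpsd : ∀ f : S → ℝ, 0 ≤ ∑ σ, π σ * f σ * (P *ᵥ f) σ) (f g : S → ℝ) :
    (∑ σ, π σ * f σ * (P *ᵥ g) σ) ^ 2 ≤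
      (∑ σ, π σ * f σ * (P *ᵥ f) σ) * ∑ σ, π σ * g σ * (P *ᵥ g) σ := by
  set a := ∑ σ, π σ * g σ * (P *ᵥ g) σ
  set b := ∑ σ, π σ * f σ * (P *ᵥ g) σ with hb
  set c := ∑ σ, π σ * f σ * (P *ᵥ f) σ
  have hb' : ∑ σ, π σ * g σ * (P *ᵥ f) σ = b := sum_mul_mulVec_comm hrev g f
  -- The form at `f + s g` is nonnegative for all `s`, so its discriminant is not positive.
  have h (s : ℝ) : 0 ≤ a * (s * s) + 2 * b * s + c := by
    have := hpsd (f + s • g)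
    have he : ∑ σ, π σ * (f + s • g) σ * (P *ᵥ (f + s • g)) σ
        = a * (s * s) + b * s + (∑ σ, π σ * g σ * (P *ᵥ f) σ) * s + c := by
      rw [mulVec_add, mulVec_smul]
      simp only [a, hb, c, Finset.sum_mul, ← Finset.sum_add_distrib, Pi.add_apply, Pi.smul_apply,
        smul_eq_mul]
      exact Finset.sum_congr rfl fun σ _ => by ring
    rw [he, hb'] at this
    linarith
  have := discrim_le_zero h
  rw [discrim] at this
  linarith

/-- A positive reversible chain with Poincaré constant `γ` contracts centred functions. -/
theorem sum_mul_mulVec_sq_le_of_gap {π : S → ℝ} {P : Matrix S S ℝ} {γ : ℝ}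
    (hπ : ∀ σ, 0 ≤ π σ) (hrev : ∀ σ τ, π σ * P σ τ = π τ * P τ σ) (hP : ∀ σ, ∑ τ, P σ τ = 1)
    (hpsd : ∀ f : S → ℝ, 0 ≤ ∑ σ, π σ * f σ * (P *ᵥ f) σ)
    (hgap : ∀ f : S → ℝ, γ * scaledVar π f ≤ ∑ σ, π σ * (f σ * (f σ - (P *ᵥ f) σ)))
    {f : S → ℝ} (hf : ∑ σ, π σ * f σ = 0) :
    ∑ σ, π σ * (P *ᵥ f) σ ^ 2 ≤ (1 - γ) ^ 2 * ∑ σ, π σ * f σ ^ 2 := by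
  have hform {g : S → ℝ} (hg : ∑ σ, π σ * g σ = 0) :
      ∑ σ, π σ * g σ * (P *ᵥ g) σ ≤ (1 - γ) * ∑ σ, π σ * g σ ^ 2 := by
    have h1 := hgap g
    rw [scaledVar, hg] at h1
    have h2 : ∑ σ, π σ * (g σ * (g σ - (P *ᵥ g) σ))
        = ∑ σ, π σ * g σ ^ 2 - ∑ σ, π σ * g σ * (P *ᵥ g) σ := by
      rw [← Finset.sum_sub_distrib]
      exact Finset.sum_congr rfl fun σ _ => by ring
    rw [h2] at h1
    norm_num at h1
    linarith
  have hPf : ∑ σ, π σ * (P *ᵥ f) σ = 0 := by rw [sum_mul_mulVec_eq hrev hP, hf]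
  set N := ∑ σ, π σ * (P *ᵥ f) σ ^ 2 with hN
  set M := ∑ σ, π σ * f σ ^ 2 with hM
  have hN0 : 0 ≤ N := Finset.sum_nonneg fun σ _ => mul_nonneg (hπ σ) (sq_nonneg _)
  have hM0 : 0 ≤ M := Finset.sum_nonneg fun σ _ => mul_nonneg (hπ σ) (sq_nonneg _)
  have hCS := sum_mul_mulVec_sq_le hrev hpsd (P *ᵥ f) f
  have hNN : ∑ σ, π σ * (P *ᵥ f) σ * (P *ᵥ f) σ = N :=
    Finset.sum_congr rfl fun σ _ => by ring
  rw [hNN] at hCS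
  -- Cauchy–Schwarz for `⟨·, P ·⟩` at `P f` and `f`, with the gap applied to both, replaces a
  -- spectral decomposition.
  have h3 : N ^ 2 ≤ ((1 - γ) * N) * ((1 - γ) * M) :=
    hCS.trans (mul_le_mul (hform hPf) (hform hf) (hpsd f) ((hpsd _).trans (hform hPf)))
  rcases hN0.eq_or_lt with h | h
  · rw [← h]
    positivity
  · have : N * N ≤ N * ((1 - γ) ^ 2 * M) := by linarith
    exact le_of_mul_le_mul_left this h

variable [DecidableEq S]

theorem mul_pow_comm {π : S → ℝ} {P : Matrix S S ℝ}
    (hrev : ∀ σ τ, π σ * P σ τ = π τ * P τ σ) (t : ℕ) (σ τ : S) :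
    π σ * (P ^ t) σ τ = π τ * (P ^ t) τ σ := by
  induction t generalizing σ τ with
  | zero =>
    rw [pow_zero, one_apply, one_apply]
    by_cases h : σ = τ
    · simp [h]
    · simp [h, Ne.symm h]
  | succ t ih =>
    rw [pow_succ, mul_apply, ← pow_succ, pow_succ', mul_apply, Finset.mul_sum, Finset.mul_sum]
    refine Finset.sum_congr rfl fun ρ _ => ?_
    calc π σ * ((P ^ t) σ ρ * P ρ τ) = π σ * (P ^ t) σ ρ * P ρ τ := by ring
      _ = (π ρ * P ρ τ) * (P ^ t) ρ σ := by rw [ih]; ring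
      _ = _ := by rw [hrev]; ring

/-- Exponential decay of the total variation distance of a positive reversible chain with
Poincaré constant `γ`. -/
theorem tvDist_pow_le {π : S → ℝ} {P : Matrix S S ℝ} {γ : ℝ}
    (hπ : ∀ σ, 0 < π σ) (hπ1 : ∑ σ, π σ = 1) (hγ : γ ≤ 1)
    (hrev : ∀ σ τ, π σ * P σ τ = π τ * P τ σ) (hP : ∀ σ, ∑ τ, P σ τ = 1)
    (hpsd : ∀ f : S → ℝ, 0 ≤ ∑ σ, π σ * f σ * (P *ᵥ f) σ)
    (hgap : ∀ f : S → ℝ, γ * scaledVar π f ≤ ∑ σ, π σ * (f σ * (f σ - (P *ᵥ f) σ)))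
    (x : S) (t : ℕ) :
    tvDist ((P ^ t) x) π ≤ 1 / 2 * ((1 - γ) ^ t * √(1 / π x - 1)) := by
  set f₀ : S → ℝ := fun τ => (if τ = x then 1 / π x else 0) - 1 with hf₀
  have hmean : ∑ σ, π σ * f₀ σ = 0 := by
    simp [hf₀, mul_sub, Finset.sum_sub_distrib, hπ1, (hπ x).ne']
  have hnorm : ∑ σ, π σ * f₀ σ ^ 2 = 1 / π x - 1 := by
    have h (σ : S) : π σ * f₀ σ ^ 2 = (if σ = x then 1 / π x else 0)
        - 2 * (if σ = x then 1 else 0) + π σ := by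
      by_cases hσ : σ = x
      · have := (hπ x).ne'
        simp only [hf₀, hσ, if_true]
        field_simp
        ring
      · simp [hf₀, hσ]
    rw [Finset.sum_congr rfl fun σ _ => h σ, Finset.sum_add_distrib, Finset.sum_sub_distrib, hπ1,
      ← Finset.mul_sum]
    simp
    ring
  have hdecay (t : ℕ) : ∑ σ, π σ * (P ^ t *ᵥ f₀) σ = 0 ∧
      ∑ σ, π σ * (P ^ t *ᵥ f₀) σ ^ 2 ≤ ((1 - γ) ^ t) ^ 2 * (1 / π x - 1) := by
    induction t with
    | zero => simp [hmean, hnorm]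
    | succ t ih =>
      rw [pow_succ', ← mulVec_mulVec]
      refine ⟨by rw [sum_mul_mulVec_eq hrev hP, ih.1], ?_⟩
      calc _ ≤ (1 - γ) ^ 2 * ∑ σ, π σ * (P ^ t *ᵥ f₀) σ ^ 2 :=
            sum_mul_mulVec_sq_le_of_gap (fun σ => (hπ σ).le) hrev hP hpsd hgap ih.1
        _ ≤ (1 - γ) ^ 2 * (((1 - γ) ^ t) ^ 2 * (1 / π x - 1)) :=
            mul_le_mul_of_nonneg_left ih.2 (sq_nonneg _)
        _ = _ := by ring
  have hPt (t : ℕ) (σ : S) : ∑ τ, (P ^ t) σ τ = 1 := by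
    induction t with
    | zero => simp [one_apply]
    | succ t ih =>
      simp only [pow_succ, mul_apply]
      rw [Finset.sum_comm]
      simp [← Finset.mul_sum, hP, ih]
  -- `f₀` is the density of the point mass at `x` minus one; by reversibility `P ^ t` carries it to
  -- the density of the law at time `t` minus one.
  have hval (τ : S) : (P ^ t) x τ - π τ = π τ * (P ^ t *ᵥ f₀) τ := by
    have h1 : (P ^ t *ᵥ f₀) τ = (P ^ t) τ x / π x - 1 := by
      simp [hf₀, mulVec, dotProduct, mul_sub, Finset.sum_sub_distrib, hPt, div_eq_mul_inv]
    have h2 := mul_pow_comm hrev t x τ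
    rw [h1]
    have := (hπ x).ne'
    field_simp
    linear_combination h2
  have hL1 : (∑ τ, |(P ^ t) x τ - π τ|) ^ 2 ≤ ((1 - γ) ^ t) ^ 2 * (1 / π x - 1) := by
    refine le_trans ?_ (hdecay t).2
    have hCS := Finset.sum_mul_sq_le_sq_mul_sq Finset.univ (fun τ => √(π τ))
      (fun τ => √(π τ) * |(P ^ t *ᵥ f₀) τ|)
    simp only [mul_pow, Real.sq_sqrt (hπ _).le, hπ1, one_mul, sq_abs, ← mul_assoc,
      Real.mul_self_sqrt (hπ _).le] at hCS
    refine le_trans (le_of_eq ?_) hCS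
    congr 1
    refine Finset.sum_congr rfl fun τ _ => ?_
    rw [hval, abs_mul, abs_of_pos (hπ τ)]
  have hpow : 0 ≤ (1 - γ) ^ t := pow_nonneg (by linarith) t
  have := Real.sqrt_le_sqrt hL1
  rw [Real.sqrt_sq (Finset.sum_nonneg fun _ _ => abs_nonneg _),
    Real.sqrt_mul (sq_nonneg _), Real.sqrt_sq hpow] at this
  rw [tvDist]
  gcongr

end ReversibleChain

/-! ### Lower bound for the tensorisation constant -/

/-- Two uses of Bernoulli: `(1 + 1/k) ^ k ≥ 2`, then `(1 - 1/2) ^ p ≤ 1 - p/2` for the exponent `p =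
2C/k ≤ 1`. The resulting bound telescopes over `k`. -/
theorem rpow_div_succ_le {C : ℝ} (hC : 0 ≤ C) {k : ℕ} (hk : 0 < k) (hCk : 2 * C ≤ k) :
    ((k : ℝ) / (k + 1)) ^ (2 * C) ≤ 1 - C / k := by
  have hk' : (0 : ℝ) < k := by exact_mod_cast hk
  have h1 : ((k : ℝ) / (k + 1)) ^ k ≤ 1 / 2 := by
    have h2 := one_add_mul_le_pow (a := 1 / (k : ℝ)) (by have : 0 < 1 / (k : ℝ) := by positivity
                                                         linarith) k
    rw [mul_one_div_cancel hk'.ne'] at h2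
    have h3 : (k : ℝ) / (k + 1) = (1 + 1 / (k : ℝ))⁻¹ := by
      field_simp
    rw [h3, inv_pow, ← one_div]
    exact one_div_le_one_div_of_le (by norm_num) (by linarith)
  have h4 := rpow_one_add_le_one_add_mul_self (s := -1 / 2) (by norm_num)
    (p := 2 * C / k) (by positivity) ((div_le_one hk').2 hCk)
  calc ((k : ℝ) / (k + 1)) ^ (2 * C) = (((k : ℝ) / (k + 1)) ^ k) ^ (2 * C / k) := by
        rw [← Real.rpow_natCast, ← Real.rpow_mul (by positivity), mul_div_cancel₀ _ hk'.ne']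
    _ ≤ (1 / 2) ^ (2 * C / k) := Real.rpow_le_rpow (by positivity) h1 (by positivity)
    _ ≤ 1 - C / k := by
        rw [show (1 : ℝ) + -1 / 2 = 1 / 2 by norm_num] at h4
        refine h4.trans (le_of_eq ?_)
        ring

/-- Factors with `j + 1 < 2C`, of which there are at most `2C`, are bounded by `1 - η`; the
remaining ones by the telescoping estimate. -/
theorem le_prod_one_sub_min {C η : ℝ} (hC : 0 ≤ C) (hη0 : 0 ≤ η) (hη1 : η < 1) (m : ℕ) :
    (1 - η) ^ (2 * C) / ((m : ℝ) + 1) ^ (2 * C) ≤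
      ∏ j ∈ Finset.range m, (1 - min η (C / ((j : ℝ) + 1))) := by
  have h1η : 0 < 1 - η := by linarith
  have hfac (j : ℕ) : (if (j : ℝ) + 1 < 2 * C then 1 - η else 1)
      * (((j : ℝ) + 1) / (j + 1 + 1)) ^ (2 * C) ≤ 1 - min η (C / ((j : ℝ) + 1)) := by
    have hle1 : (((j : ℝ) + 1) / (j + 1 + 1)) ^ (2 * C) ≤ 1 :=
      Real.rpow_le_one (by positivity) ((div_le_one (by positivity)).2 (by linarith))
        (by positivity)
    split_ifs with hj
    · calc _ ≤ (1 - η) * 1 := mul_le_mul_of_nonneg_left hle1 h1η.le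
        _ ≤ _ := by
          have := min_le_left η (C / ((j : ℝ) + 1))
          linarith
    · have := rpow_div_succ_le hC (Nat.succ_pos j) (by push_cast; linarith)
      push_cast at this
      rw [one_mul]
      refine this.trans ?_
      have := min_le_right η (C / ((j : ℝ) + 1))
      linarith
  have htel : ∏ j ∈ Finset.range m, (((j : ℝ) + 1) / (j + 1 + 1)) ^ (2 * C)
      = 1 / ((m : ℝ) + 1) ^ (2 * C) := by
    induction m with
    | zero => simp
    | succ m ih =>
      rw [Finset.prod_range_succ, ih, Real.div_rpow (by positivity) (by positivity)]
      have : ((m : ℝ) + 1) ^ (2 * C) ≠ 0 := by positivity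
      push_cast
      field_simp
  have hcount : (1 - η) ^ (2 * C) ≤
      ∏ j ∈ Finset.range m, (if (j : ℝ) + 1 < 2 * C then 1 - η else 1) := by
    rw [← Finset.prod_filter, Finset.prod_const, ← Real.rpow_natCast]
    refine Real.rpow_le_rpow_of_exponent_ge h1η (by linarith) ?_
    have hsub : (Finset.range m).filter (fun j : ℕ => (j : ℝ) + 1 < 2 * C)
        ⊆ Finset.range ⌊2 * C⌋₊ := by
      intro j hj
      rw [Finset.mem_range, ← Nat.succ_le_iff]
      refine Nat.le_floor ?_
      push_cast
      exact (Finset.mem_filter.1 hj).2.le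
    have := Finset.card_le_card hsub
    rw [Finset.card_range] at this
    exact (Nat.cast_le.2 this).trans (Nat.floor_le (by positivity))
  calc (1 - η) ^ (2 * C) / ((m : ℝ) + 1) ^ (2 * C)
      = (1 - η) ^ (2 * C) * (1 / ((m : ℝ) + 1) ^ (2 * C)) := by ring
    _ ≤ (∏ j ∈ Finset.range m, (if (j : ℝ) + 1 < 2 * C then 1 - η else 1)) *
          ∏ j ∈ Finset.range m, (((j : ℝ) + 1) / (j + 1 + 1)) ^ (2 * C) := by
        rw [← htel]
        exact mul_le_mul_of_nonneg_right hcount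
          (Finset.prod_nonneg fun j _ => by positivity)
    _ ≤ _ := by
        rw [← Finset.prod_mul_distrib]
        refine Finset.prod_le_prod (fun j _ => mul_nonneg ?_ (by positivity)) fun j _ => hfac j
        split_ifs
        · exact h1η.le
        · exact zero_le_one

/-! ### The Glauber kernel, its spectral gap and its mixing -/

section Glauber

variable {V : Type*} {q : ℕ}

theorem mem_agreeOff_iff {v : V} {σ ρ : V → Fin q} :
    ρ ∈ agreeOff v σ ↔ (fun w : {w // w ≠ v} => ρ w) = fun w : {w // w ≠ v} => σ w := by
  rw [funext_iff, Subtype.forall]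
  rfl

theorem agreeOff_congr {v : V} {σ τ : V → Fin q} (h : τ ∈ agreeOff v σ) :
    agreeOff v τ = agreeOff v σ := by
  ext ρ
  rw [mem_agreeOff_iff, mem_agreeOff_iff, mem_agreeOff_iff.1 h]

/-- The extension by zero of a function on the support. -/
noncomputable def extendZero {μ : (V → Fin q) → ℝ} (f : Support μ → ℝ) (σ : V → Fin q) : ℝ :=
  open Classical in if h : 0 < μ σ then f ⟨σ, h⟩ else 0

theorem extendZero_coe {μ : (V → Fin q) → ℝ} (f : Support μ → ℝ) :
    (fun σ : Support μ => extendZero f σ.1) = f := by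
  funext σ
  simp [extendZero, σ.2]

variable [Fintype V] [DecidableEq V]

theorem sum_indicator_agreeOff (v : V) (F : (V → Fin q) → ℝ) (σ : V → Fin q) :
    ∑ ρ, (agreeOff v σ).indicator F ρ
      = fiberSum (fun (ρ : V → Fin q) (w : {w // w ≠ v}) => ρ w) F (fun w => σ w) := by
  classical
  simp only [fiberSum, Set.indicator_apply, mem_agreeOff_iff]

theorem siteAvg_eq (μ : (V → Fin q) → ℝ) (v : V) (f : (V → Fin q) → ℝ) (σ : V → Fin q) :
    siteAvg μ v f σ
      = fiberSum (fun (ρ : V → Fin q) (w : {w // w ≠ v}) => ρ w) (fun ρ => μ ρ * f ρ) (fun w => σ w)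
        / fiberSum (fun (ρ : V → Fin q) (w : {w // w ≠ v}) => ρ w) μ (fun w => σ w) := by
  rw [siteAvg, prob, sum_indicator_agreeOff, sum_indicator_agreeOff]

/-- Resampling a site is an orthogonal projection: grouped by the values off `v`, the form is a sum
of squares over nonnegative weights. -/
theorem sum_mul_siteAvg_nonneg {μ : (V → Fin q) → ℝ} (hμ : ∀ σ, 0 ≤ μ σ) (v : V)
    (f : (V → Fin q) → ℝ) : 0 ≤ ∑ σ, μ σ * f σ * siteAvg μ v f σ := by
  set Y := fun (ρ : V → Fin q) (w : {w // w ≠ v}) => ρ w with hY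
  have h (σ : V → Fin q) : μ σ * f σ * siteAvg μ v f σ = μ σ * f σ *
      (fun c => fiberSum Y (fun ρ => μ ρ * f ρ) c / fiberSum Y μ c) (Y σ) := by
    rw [siteAvg_eq]
  rw [Finset.sum_congr rfl fun σ _ => h σ, sum_mul_comp_eq Y (fun σ => μ σ * f σ)
    fun c => fiberSum Y (fun ρ => μ ρ * f ρ) c / fiberSum Y μ c]
  refine Finset.sum_nonneg fun c _ => ?_
  rw [mul_div_assoc']
  exact div_nonneg (mul_self_nonneg _) (fiberSum_nonneg hμ Y c)

theorem prob_agreeOff_pos {μ : (V → Fin q) → ℝ} (hμ : ∀ σ, 0 ≤ μ σ) (v : V) {σ : V → Fin q}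
    (hσ : 0 < μ σ) : 0 < prob μ (agreeOff v σ) := by
  rw [prob, sum_indicator_agreeOff]
  exact hσ.trans_le
    (le_fiberSum hμ (fun (ρ : V → Fin q) (w : {w // w ≠ v}) => ρ w) σ)

theorem siteAvg_one {μ : (V → Fin q) → ℝ} (hμ : ∀ σ, 0 ≤ μ σ) (v : V) {σ : V → Fin q}
    (hσ : 0 < μ σ) : siteAvg μ v (fun _ => 1) σ = 1 := by
  simp only [siteAvg, mul_one]
  exact div_self (prob_agreeOff_pos hμ v hσ).ne'

theorem condMarginal_agreeOff (μ : (V → Fin q) → ℝ) {v : V} {σ τ : V → Fin q}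
    (h : τ ∈ agreeOff v σ) :
    condMarginal μ (agreeOff v σ) v (τ v) = μ τ / prob μ (agreeOff v σ) := by
  classical
  have hset : agreeOff v σ ∩ {ρ | ρ v = τ v} = {τ} := by
    ext ρ
    rw [← agreeOff_congr h, Set.mem_singleton_iff]
    refine ⟨fun ⟨h1, h2⟩ => funext fun w => ?_, ?_⟩
    · by_cases hw : w = v
      · rw [hw]
        exact h2
      · exact h1 w hw
    · rintro rfl
      exact ⟨fun _ _ => rfl, rfl⟩
  rw [condMarginal, hset]
  congr 1
  simp [prob, Set.indicator_apply]

theorem sum_support_eq {μ G : (V → Fin q) → ℝ} (hG : ∀ σ, ¬ 0 < μ σ → G σ = 0) :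
    ∑ σ : Support μ, G σ.1 = ∑ σ, G σ := by
  rw [← Finset.sum_subtype (Finset.univ.filter fun σ => 0 < μ σ) (by simp) G]
  refine Finset.sum_filter_of_ne fun σ _ h => ?_
  by_contra h'
  exact h (hG σ h')

theorem glauber_apply (μ : (V → Fin q) → ℝ) (σ τ : Support μ) :
    glauber μ σ τ = 1 / (Fintype.card V : ℝ) *
      ∑ v, (agreeOff v σ.1).indicator μ τ.1 / prob μ (agreeOff v σ.1) := by
  classical
  rw [glauber]
  congr 1
  refine Finset.sum_congr rfl fun v _ => ?_
  split_ifs with h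
  · have h' : τ.1 ∈ agreeOff v σ.1 := h
    rw [Set.indicator_of_mem h']
    exact condMarginal_agreeOff μ h'
  · have h' : τ.1 ∉ agreeOff v σ.1 := h
    rw [Set.indicator_of_notMem h', zero_div]

theorem glauber_mulVec {μ : (V → Fin q) → ℝ} (hμ : ∀ σ, 0 ≤ μ σ) (f : (V → Fin q) → ℝ)
    (σ : Support μ) :
    (glauber μ).mulVec (fun τ => f τ.1) σ
      = 1 / (Fintype.card V : ℝ) * ∑ v, siteAvg μ v f σ.1 := by
  simp only [Matrix.mulVec, dotProduct, glauber_apply, mul_assoc, ← Finset.mul_sum]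
  congr 1
  simp only [Finset.sum_mul]
  rw [Finset.sum_comm]
  refine Finset.sum_congr rfl fun v _ => ?_
  rw [siteAvg, Finset.sum_div, ← sum_support_eq (μ := μ)]
  · refine Finset.sum_congr rfl fun τ _ => ?_
    rw [Set.indicator_mul_left]
    ring
  · intro τ hτ
    have : μ τ = 0 := le_antisymm (not_lt.1 hτ) (hμ τ)
    rw [Set.indicator_mul_left]
    simp [Set.indicator, this]

theorem glauber_reversible (μ : (V → Fin q) → ℝ) (σ τ : Support μ) :
    μ σ.1 * glauber μ σ τ = μ τ.1 * glauber μ τ σ := by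
  rw [glauber_apply, glauber_apply, mul_left_comm, mul_left_comm (μ τ.1)]
  congr 1
  rw [Finset.mul_sum, Finset.mul_sum]
  refine Finset.sum_congr rfl fun v _ => ?_
  by_cases h : τ.1 ∈ agreeOff v σ.1
  · have h' : σ.1 ∈ agreeOff v τ.1 := mem_agreeOff_iff.2 (mem_agreeOff_iff.1 h).symm
    rw [Set.indicator_of_mem h, Set.indicator_of_mem h', agreeOff_congr h]
    ring
  · have h' : σ.1 ∉ agreeOff v τ.1 := fun h' =>
      h (mem_agreeOff_iff.2 (mem_agreeOff_iff.1 h').symm)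
    rw [Set.indicator_of_notMem h, Set.indicator_of_notMem h']
    simp

theorem sum_support_mul {μ : (V → Fin q) → ℝ} (hμ : ∀ σ, 0 ≤ μ σ) (G : (V → Fin q) → ℝ) :
    ∑ σ : Support μ, μ σ.1 * G σ.1 = ∑ σ, μ σ * G σ :=
  sum_support_eq (G := fun σ => μ σ * G σ) fun σ hσ => by
    have : μ σ = 0 := le_antisymm (not_lt.1 hσ) (hμ σ)
    simp [this]

theorem glauber_row_sum {μ : (V → Fin q) → ℝ} (hμ : ∀ σ, 0 ≤ μ σ) [Nonempty V] (σ : Support μ) :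
    ∑ τ, glauber μ σ τ = 1 := by
  have := glauber_mulVec hμ (fun _ => 1) σ
  simp only [Matrix.mulVec, dotProduct, mul_one, siteAvg_one hμ _ σ.2, Finset.sum_const,
    Finset.card_univ, nsmul_eq_mul] at this
  rw [this, one_div_mul_cancel]
  positivity

theorem glauber_form_nonneg {μ : (V → Fin q) → ℝ} (hμ : ∀ σ, 0 ≤ μ σ) (f : Support μ → ℝ) :
    0 ≤ ∑ σ, μ σ.1 * f σ * (glauber μ).mulVec f σ := by
  rw [← extendZero_coe f]
  simp only [glauber_mulVec hμ, mul_assoc]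
  rw [sum_support_mul hμ fun σ => extendZero f σ *
    (1 / (Fintype.card V : ℝ) * ∑ v, siteAvg μ v (extendZero f) σ)]
  have : ∑ σ, μ σ * (extendZero f σ *
      (1 / (Fintype.card V : ℝ) * ∑ v, siteAvg μ v (extendZero f) σ))
      = 1 / (Fintype.card V : ℝ) *
        ∑ v, ∑ σ, μ σ * extendZero f σ * siteAvg μ v (extendZero f) σ := by
    rw [Finset.sum_comm, Finset.mul_sum]
    refine Finset.sum_congr rfl fun σ _ => ?_
    rw [← Finset.mul_sum]
    ring
  rw [this]
  exact mul_nonneg (by positivity) (Finset.sum_nonneg fun v _ => sum_mul_siteAvg_nonneg hμ v _)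

/-- The Poincaré inequality for the Glauber dynamics of a spectrally independent distribution. -/
theorem glauber_gap [Nonempty V] {μ : (V → Fin q) → ℝ} (hμ : ∀ σ, 0 ≤ μ σ) {C η : ℝ}
    (hC : 0 ≤ C) (hη0 : 0 ≤ η) (hη1 : η < 1) (hSI : SpectrallyIndependent μ C η)
    (f : Support μ → ℝ) :
    (1 - η) ^ (2 * C) / (Fintype.card V : ℝ) ^ (1 + 2 * C)
        * scaledVar (fun σ : Support μ => μ σ.1) f
      ≤ ∑ σ : Support μ, μ σ.1 * (f σ * (f σ - (glauber μ).mulVec f σ)) := by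
  set n : ℝ := (Fintype.card V : ℝ) with hn
  have hn0 : 0 < n := by positivity
  obtain ⟨m, hm⟩ : ∃ m, m + 1 = Fintype.card V :=
    ⟨Fintype.card V - 1, Nat.sub_add_cancel Fintype.card_pos⟩
  have hmn : (m : ℝ) + 1 = n := by rw [hn, ← hm]; push_cast; rfl
  obtain ⟨F, hF⟩ : ∃ F : (V → Fin q) → ℝ, (fun σ : Support μ => F σ.1) = f :=
    ⟨extendZero f, extendZero_coe f⟩
  subst hF
  have hvar : scaledVar (fun σ : Support μ => μ σ.1) (fun σ => F σ.1) = scaledVar μ F := by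
    rw [scaledVar, scaledVar, sum_support_mul hμ fun σ => F σ ^ 2, sum_support_mul hμ F,
      sum_support_eq fun σ hσ => le_antisymm (not_lt.1 hσ) (hμ σ)]
  have hform : ∑ σ : Support μ, μ σ.1 *
      (F σ.1 * (F σ.1 - (glauber μ).mulVec (fun σ => F σ.1) σ))
      = 1 / n * ∑ v, siteForm μ v Set.univ F := by
    simp only [glauber_mulVec hμ]
    rw [sum_support_mul hμ fun σ => F σ * (F σ - 1 / n * ∑ v, siteAvg μ v F σ)]
    simp only [siteForm, Set.indicator_univ]
    rw [Finset.sum_comm, Finset.mul_sum]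
    refine Finset.sum_congr rfl fun σ _ => ?_
    simp only [mul_sub, Finset.sum_sub_distrib, ← Finset.mul_sum, Finset.sum_const,
      Finset.card_univ, nsmul_eq_mul, ← hn]
    field_simp
  rw [hvar, hform]
  -- Tensorisation is applied with nothing pinned, but it still takes a reference configuration `τ`.
  rcases isEmpty_or_nonempty (V → Fin q) with hE | ⟨⟨τ⟩⟩
  · simp [scaledVar, siteForm]
  have hAT := scaledVar_agreeOn_le hμ hη1 hSI F m ∅ (by simpa using hm) τ
  have huniv : agreeOn ∅ τ = Set.univ := by
    ext ρ
    simp [agreeOn]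
  rw [huniv, Set.indicator_univ, Finset.compl_empty] at hAT
  have hprod := le_prod_one_sub_min hC hη0 hη1 m
  have h1η : 0 < 1 - η := by linarith
  rw [hmn] at hprod
  set K := ∏ j ∈ Finset.range m, (1 - min η (C / ((j : ℝ) + 1)))
  have hlow : 0 < (1 - η) ^ (2 * C) / n ^ (2 * C) := by positivity
  have hK : 0 < K := hlow.trans_le hprod
  rw [inv_mul_eq_div, le_div_iff₀ hK] at hAT
  have hV := scaledVar_nonneg hμ F
  calc (1 - η) ^ (2 * C) / n ^ (1 + 2 * C) * scaledVar μ F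
      = 1 / n * ((1 - η) ^ (2 * C) / n ^ (2 * C) * scaledVar μ F) := by
        rw [Real.rpow_add hn0, Real.rpow_one]
        field_simp
    _ ≤ 1 / n * (K * scaledVar μ F) := by gcongr
    _ ≤ _ := by
        gcongr
        linarith

theorem tvDist_glauber_pow_le [Nonempty V] {μ : (V → Fin q) → ℝ}
    (hμ : μ ∈ stdSimplex ℝ (V → Fin q)) {C η : ℝ} (hC : 0 ≤ C) (hη0 : 0 ≤ η) (hη1 : η < 1)
    (hSI : SpectrallyIndependent μ C η) {ε : ℝ} (hε0 : 0 < ε) (x : Support μ) {t : ℕ}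
    (hmin : 0 < minProb μ)
    (ht : (Fintype.card V : ℝ) ^ (1 + 2 * C) / (1 - η) ^ (2 + 2 * C) *
        Real.log (1 / (ε * minProb μ)) ≤ t + 1)
    (hlog : 0 ≤ Real.log (1 / (ε * minProb μ))) :
    tvDist ((glauber μ ^ t) x) (fun σ : Support μ => μ σ.1) ≤ ε := by
  set n : ℝ := (Fintype.card V : ℝ) with hn
  set L := Real.log (1 / (ε * minProb μ)) with hL
  have hn1 : 1 ≤ n := by
    rw [hn]
    exact_mod_cast Fintype.card_pos
  have hn0 : 0 < n := by linarith
  have h1η : 0 < 1 - η := by linarith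
  set γ := (1 - η) ^ (2 * C) / n ^ (1 + 2 * C) with hγdef
  have hγ0 : 0 < γ := by positivity
  have hγ1 : γ ≤ 1 := by
    refine div_le_one_of_le₀ ?_ (by positivity)
    exact (Real.rpow_le_one h1η.le (by linarith) (by positivity)).trans
      (Real.one_le_rpow hn1 (by positivity))
  have hsum : ∑ σ : Support μ, μ σ.1 = 1 := by
    rw [sum_support_eq fun σ hσ => le_antisymm (not_lt.1 hσ) (hμ.1 σ)]
    exact hμ.2
  have htv := tvDist_pow_le (π := fun σ : Support μ => μ σ.1) (fun σ => σ.2) hsum hγ1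
    (glauber_reversible μ) (glauber_row_sum hμ.1) (glauber_form_nonneg hμ.1)
    (glauber_gap hμ.1 hC hη0 hη1 hSI) x t
  -- Only `t + 1` reaches the bound, since `t` will be a floor; the loss is `γ ≤ 1`, a factor `e`
  -- after exponentiation. The spare `(1 - η) ^ (-2)` is discarded.
  have hγt : L - 1 ≤ γ * t := by
    have h1 : L ≤ γ * (n ^ (1 + 2 * C) / (1 - η) ^ (2 + 2 * C) * L) := by
      have h2 : γ * (n ^ (1 + 2 * C) / (1 - η) ^ (2 + 2 * C)) = 1 / (1 - η) ^ (2 : ℝ) := by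
        rw [hγdef, Real.rpow_add h1η 2]
        field_simp
      rw [← mul_assoc, h2]
      refine le_mul_of_one_le_left hlog ?_
      rw [le_div_iff₀ (by positivity), one_mul]
      exact Real.rpow_le_one h1η.le (by linarith) (by norm_num)
    have h3 := mul_le_mul_of_nonneg_left ht hγ0.le
    linarith
  have hpow : (1 - γ) ^ t ≤ Real.exp 1 * (ε * minProb μ) := by
    calc (1 - γ) ^ t ≤ Real.exp (-γ) ^ t := by
          refine pow_le_pow_left₀ (by linarith) ?_ t
          have := Real.add_one_le_exp (-γ)
          linarith
      _ = Real.exp (-(γ * t)) := by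
          rw [← Real.exp_nat_mul]
          congr 1
          ring
      _ ≤ Real.exp (1 - L) := Real.exp_le_exp.2 (by linarith)
      _ = _ := by
          rw [Real.exp_sub, hL, Real.exp_log (by positivity)]
          field_simp
  have hx : minProb μ ≤ μ x.1 :=
    ciInf_le (f := fun σ : Support μ => μ σ.1) (Set.finite_range _).bddBelow x
  -- From `(1 / (2p) - 1) ^ 2 ≥ 0` with `p = μ x`. With the `1/2` in total variation this gives `e /
  -- 4 < 1`, absorbing the rounding loss.
  have hroot : minProb μ * √(1 / μ x.1 - 1) ≤ 1 / 2 := by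
    have hx0 := x.2
    have h1 : √(1 / μ x.1 - 1) ≤ 1 / (2 * μ x.1) := by
      refine Real.sqrt_le_iff.2 ⟨by positivity, ?_⟩
      rw [← sub_nonneg]
      have : (1 / (2 * μ x.1)) ^ 2 - (1 / μ x.1 - 1) = (1 / (2 * μ x.1) - 1) ^ 2 := by
        field_simp
        ring
      rw [this]
      positivity
    calc minProb μ * √(1 / μ x.1 - 1) ≤ μ x.1 * (1 / (2 * μ x.1)) := by gcongr
      _ = 1 / 2 := by field_simp
  have he := Real.exp_one_lt_d9
  calc _ ≤ 1 / 2 * ((1 - γ) ^ t * √(1 / μ x.1 - 1)) := htv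
    _ ≤ 1 / 2 * (Real.exp 1 * (ε * minProb μ) * √(1 / μ x.1 - 1)) := by gcongr
    _ = 1 / 2 * Real.exp 1 * ε * (minProb μ * √(1 / μ x.1 - 1)) := by ring
    _ ≤ 1 / 2 * Real.exp 1 * ε * (1 / 2) := by gcongr
    _ = Real.exp 1 / 4 * ε := by ring
    _ ≤ 1 * ε := by
        gcongr
        linarith
    _ = ε := one_mul ε

end Glauber

end SpinSystem

/-! ### The mixing time bound -/

theorem theorem1p3 {V : Type*} [Fintype V] [DecidableEq V] (q : ℕ)
    (μ : (V → Fin q) → ℝ) (hμ : μ ∈ stdSimplex ℝ (V → Fin q))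
    (C η : ℝ) (hC : 0 ≤ C) (hη0 : 0 ≤ η) (hη1 : η < 1)
    (hSI : SpinSystem.SpectrallyIndependent μ C η)
    (ε : ℝ) (hε0 : 0 < ε) (hε1 : ε < 1) :
    ∃ T : ℕ, SpinSystem.mixingTime μ ε = (T : ℕ∞) ∧
      (T : ℝ) ≤ (Fintype.card V : ℝ) ^ (1 + 2 * C) / (1 - η) ^ (2 + 2 * C) *
        Real.log (1 / (ε * SpinSystem.minProb μ)) := by
  set B := (Fintype.card V : ℝ) ^ (1 + 2 * C) / (1 - η) ^ (2 + 2 * C) *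
    Real.log (1 / (ε * SpinSystem.minProb μ)) with hB
  have h1η : 0 < 1 - η := by linarith
  have hle1 (σ : V → Fin q) : μ σ ≤ 1 := by
    rw [← hμ.2]
    exact Finset.single_le_sum (fun τ _ => hμ.1 τ) (Finset.mem_univ σ)
  have hne : Nonempty (SpinSystem.Support μ) := by
    obtain ⟨σ, -, hσ⟩ := Finset.exists_ne_zero_of_sum_ne_zero (hμ.2.trans_ne one_ne_zero)
    exact ⟨σ, (hμ.1 σ).lt_of_ne' hσ⟩
  obtain ⟨σ₀, hσ₀⟩ := exists_eq_ciInf_of_finite (f := fun σ : SpinSystem.Support μ => μ σ.1)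
  have hmin0 : 0 < SpinSystem.minProb μ := by
    rw [SpinSystem.minProb, ← hσ₀]
    exact σ₀.2
  have hmin1 : SpinSystem.minProb μ ≤ 1 := by
    rw [SpinSystem.minProb, ← hσ₀]
    exact hle1 _
  have hlog : 0 ≤ Real.log (1 / (ε * SpinSystem.minProb μ)) := by
    refine Real.log_nonneg ?_
    rw [le_div_iff₀ (by positivity), one_mul]
    exact mul_le_one₀ hε1.le hmin0.le hmin1
  have hB0 : 0 ≤ B := mul_nonneg (by positivity) hlog
  obtain ⟨t, htB, ht⟩ : ∃ t : ℕ, (t : ℝ) ≤ B ∧ ∀ x : SpinSystem.Support μ,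
      SpinSystem.tvDist ((SpinSystem.glauber μ ^ t) x) (fun σ : SpinSystem.Support μ => μ σ.1)
        ≤ ε := by
    -- Without sites the kernel is the zero matrix, not stochastic, but the single configuration is
    -- already stationary at time `0`.
    rcases isEmpty_or_nonempty V with hV | hV
    · refine ⟨0, by simpa using hB0, fun x => ?_⟩
      have hx (σ : SpinSystem.Support μ) : μ σ.1 = 1 := by
        rw [← hμ.2, Fintype.sum_subsingleton _ σ.1]
      have : SpinSystem.tvDist ((SpinSystem.glauber μ ^ 0) x)
          (fun σ : SpinSystem.Support μ => μ σ.1) = 0 := by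
        rw [SpinSystem.tvDist, Fintype.sum_subsingleton _ x]
        simp [hx]
      rw [this]
      exact hε0.le
    · exact ⟨⌊B⌋₊, Nat.floor_le hB0, fun x =>
        SpinSystem.tvDist_glauber_pow_le hμ hC hη0 hη1 hSI hε0 x hmin0 (Nat.lt_floor_add_one B).le
          hlog⟩
  have hmix : SpinSystem.mixingTime μ ε ≤ (t : ℕ∞) :=
    iSup_le fun x => iInf_le_of_le ⟨t, ht x⟩ le_rfl
  obtain ⟨T, hT⟩ := ENat.ne_top_iff_exists.1 (ne_top_of_le_ne_top (ENat.natCast_ne_top t) hmix)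
  refine ⟨T, hT.symm, ?_⟩
  rw [← hT, Nat.cast_le] at hmix
  exact (Nat.cast_le.2 hmix).trans htB
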